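/- Let $n\in\mathbb N=\{1,2,\dots\}$. For $j\in\mathbb N_0$ and $m\in\mathbb Z^n$ let $Q_{j,m}\subset\mathbb R^n$ be the closed cube with sides parallel to the axes, centre $2^{-j}m$ and side length $2^{-j+1}$, and let $dQ_{j,m}$ be the concentric cube with side length $d\,2^{-j+1}$. For $0<p,q\le\infty$, $s\in\mathbb R$ and $\lambda=\{\lambda_{j,m}\in\mathbb C: j\in\mathbb N_0,\ m\in\mathbb Z^n\}$ put $$\|\lambda|b^s_{p,q}\|=\Big(\sum_{j=0}^\infty 2^{j(s-n/p)q}\Big(\sum_{m\in\mathbb Z^n}|\lambda_{j,m}|^p\Big)^{q/p}\Big)^{1/q}$$ (with suprema in place of the sums, and $n/p=0$, in the usual way if $p=\infty$ and/or $q=\infty$), and let $b^s_{p,q}$ be the set of all $\lambda$ with $\|\lambda|b^s_{p,q}\|<\infty$. For functions $a_{j,m}$ with $\operatorname{supp}a_{j,m}\subset dQ_{j,m}$, we say that $f=\sum_{j=0}^\infty\sum_{m\in\mathbb Z^n}\lambda_{j,m}a_{j,m}$ with convergence in $L_p(\mathbb R^n)$ if the partial sums $\sum_{j<J}\sum_m\lambda_{j,m}a_{j,m}$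 (the sum over $m$ being locally finite) converge to $f$ in $L_p(\mathbb R^n)$ as $J\to\infty$. All functions are complex-valued. *Besov spaces.* For $K\in\mathbb N_0$ and $d>1$, a $K$-times continuously differentiable function $a$ is a $K$-atom located at $Q_{j,m}$ if $\operatorname{supp}a\subset dQ_{j,m}$ and $|D^\alpha a(x)|\le 2^{|\alpha|j}$ for all $x$ and all $|\alpha|\le K$. Let $s>0$, $0<p,q\le\infty$, and fix $d>1$ and $K\ge 1+[s]$, where $[s]$ is the integer part of $s$. Then $\mathbf B^s_{p,q}(\mathbb R^n)$ consists of all $f\in L_p(\mathbb R^n)$ that can be written as $f=\sum_{j,m}\lambda_{j,m}a_{j,m}$ with convergence in $L_p(\mathbb R^n)$, where $a_{j,m}$ is a $K$-atom located at $Q_{j,m}$ and $\lambda\in b^s_{p,q}$; and $\|f|\mathbf B^s_{p,q}(\mathbb R^n)\|$ is the infimum of $\|\lambda|b^s_{p,q}\|$ over all such representations. Put $\mathbf B^\sigma_p=\mathbf B^\sigma_{p,p}$. The parameters $K$ and $d$ used for $\mathbf B^s_{p,q}$, those used for $\mathbf B^\sigma_p$, and the number $d$ in the theorem below may be chosen independently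 of one another. *Non-smooth atoms.* For $\sigma>0$, $0<p\le\infty$ and $d>1$, a function $a\in\mathbf B^\sigma_p(\mathbb R^n)$ is a $(\sigma,p)$-atom located at $Q_{j,m}$ if $\operatorname{supp}a\subset dQ_{j,m}$ and $\|a(2^{-j}\cdot)|\mathbf B^\sigma_p(\mathbb R^n)\|\le 1$. **Theorem.** Let $0<p,q\le\infty$, $0<s<\sigma$ and $d>1$. Then $f\in L_p(\mathbb R^n)$ belongs to $\mathbf B^s_{p,q}(\mathbb R^n)$ if, and only if, it can be represented as $$f=\sum_{j=0}^\infty\sum_{m\in\mathbb Z^n}\lambda_{j,m}a_{j,m}\qquad(*)$$ with convergence in $L_p(\mathbb R^n)$, where $a_{j,m}$ is a $(\sigma,p)$-atom located at $Q_{j,m}$ (so $\operatorname{supp}a_{j,m}\subset dQ_{j,m}$) for all $j\in\mathbb N_0$, $m\in\mathbb Z^n$, and $\lambda\in b^s_{p,q}$. Furthermore, there is a constant $C>0$, independent of $f$ (it may depend on $n$, $p$, $q$, $s$, $\sigma$, $d$ and on the parameters fixed in the definitions of $\mathbf B^s_{p,q}$ and $\mathbf B^\sigma_p$), such that for every $f\in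 L_p(\mathbb R^n)$ $$C^{-1}\inf\|\lambda|b^s_{p,q}\|\le\|f|\mathbf B^s_{p,q}(\mathbb R^n)\|\le C\inf\|\lambda|b^s_{p,q}\|,$$ where the infimum is taken over all admissible representations $(*)$ (and an infimum over no representation is $\infty$). -/

import Mathlib

open MeasureTheory Filter Topology
open scoped ENNReal NNReal

namespace AtomicBesov

noncomputable section

/-- Euclidean `n`-space. -/
abbrev E (n : ℕ) : Type := EuclideanSpace ℝ (Fin n)

/-- The closed cube `d Q_{j,m}`, concentric with `Q_{j,m}`, where `Q_{j,m}` is the axis-parallel cube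
centred at `2^{-j} m` with side length `2^{-j+1}` (so the half side of `d Q_{j,m}` is `d 2^{-j}`). -/
def cube {n : ℕ} (d : ℝ) (j : ℕ) (m : Fin n → ℤ) : Set (E n) :=
  {x | ∀ i, |x i - (2 : ℝ) ^ (-(j : ℤ)) * (m i : ℝ)| ≤ d * (2 : ℝ) ^ (-(j : ℤ))}

/-- The `ℓ_p` quasi-norm, `0 < p ≤ ∞`, of a family of elements of `[0, ∞]`. -/
def ellENorm {ι : Type} (p : ℝ≥0∞) (c : ι → ℝ≥0∞) : ℝ≥0∞ :=
  if p = ∞ then ⨆ i, c i else (∑' i, c i ^ p.toReal) ^ (1 / p.toReal)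

/-- The (possibly infinite) quasi-norm `‖c | b^s_{p,q}‖`. For `p = ∞` the exponent `n / p` is `0`,
which is what `(n : ℝ) / (∞ : ℝ≥0∞).toReal = n / 0 = 0` gives. -/
def seqENorm {n : ℕ} (s : ℝ) (p q : ℝ≥0∞) (c : ℕ → (Fin n → ℤ) → ℂ) : ℝ≥0∞ :=
  ellENorm q fun j : ℕ =>
    (2 : ℝ≥0∞) ^ ((j : ℝ) * (s - (n : ℝ) / p.toReal)) * ellENorm p fun m => ‖c j m‖ₑ

/-- `J`-th partial sum of `∑_j ∑_m c_{j,m} a_{j,m}`. For functions `a_{j,m}` vanishing off `d Q_{j,m}`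
the inner sum has, at every point, only finitely many nonzero terms. -/
def partialSum {n : ℕ} (c : ℕ → (Fin n → ℤ) → ℂ) (a : ℕ → (Fin n → ℤ) → E n → ℂ)
    (J : ℕ) (x : E n) : ℂ :=
  ∑ j ∈ Finset.range J, ∑' m, c j m * a j m x

/-- `f = ∑_j ∑_m c_{j,m} a_{j,m}` with convergence in `L_p`. -/
def ConvergesInLp {n : ℕ} (p : ℝ≥0∞) (f : E n → ℂ) (c : ℕ → (Fin n → ℤ) → ℂ)
    (a : ℕ → (Fin n → ℤ) → E n → ℂ) : Prop :=
  Tendsto (fun J => eLpNorm (fun x => f x - partialSum c a J x) p volume) atTop (𝓝 0)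

/-- `(c, a)` is an admissible representation of `f`, where `Atom j m` is the class of functions that
are allowed as atoms located at `Q_{j,m}`. -/
def IsRepr {n : ℕ} (Atom : ℕ → (Fin n → ℤ) → (E n → ℂ) → Prop) (s : ℝ) (p q : ℝ≥0∞)
    (f : E n → ℂ) (c : ℕ → (Fin n → ℤ) → ℂ) (a : ℕ → (Fin n → ℤ) → E n → ℂ) : Prop :=
  (∀ j m, Atom j m (a j m)) ∧ seqENorm s p q c < ∞ ∧ ConvergesInLp p f c a

/-- The infimum of `‖c | b^s_{p,q}‖` over all admissible representations of `f`
(`∞` if there is none). -/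
def reprENorm {n : ℕ} (Atom : ℕ → (Fin n → ℤ) → (E n → ℂ) → Prop) (s : ℝ) (p q : ℝ≥0∞)
    (f : E n → ℂ) : ℝ≥0∞ :=
  ⨅ (c : ℕ → (Fin n → ℤ) → ℂ) (a : ℕ → (Fin n → ℤ) → E n → ℂ) (_ : IsRepr Atom s p q f c a),
    seqENorm s p q c

/-- `a` is a (smooth) `K`-atom located at `Q_{j,m}`. The values of the `k`-th derivative at `k`-tuples
of standard basis vectors are exactly the partial derivatives `D^α a` with `|α| = k`. -/
def IsSmoothAtom {n : ℕ} (K : ℕ) (d : ℝ) (j : ℕ) (m : Fin n → ℤ) (a : E n → ℂ) : Prop :=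
  ContDiff ℝ (K : WithTop ℕ∞) a ∧ tsupport a ⊆ cube d j m ∧
    ∀ k ≤ K, ∀ (v : Fin k → Fin n) (x : E n),
      ‖iteratedFDeriv ℝ k a x fun l => EuclideanSpace.single (v l) (1 : ℝ)‖ ≤ (2 : ℝ) ^ (k * j)

/-- Membership in the Besov space `B^s_{p,q}(ℝⁿ)`, built with `K`-atoms and dilation factor `d`. -/
def MemBesov {n : ℕ} (K : ℕ) (d s : ℝ) (p q : ℝ≥0∞) (f : E n → ℂ) : Prop :=
  MemLp f p volume ∧ ∃ c a, IsRepr (IsSmoothAtom K d) s p q f c a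

/-- The Besov quasi-norm `‖f | B^s_{p,q}(ℝⁿ)‖`, built with `K`-atoms and dilation factor `d`. -/
def besovENorm {n : ℕ} (K : ℕ) (d s : ℝ) (p q : ℝ≥0∞) (f : E n → ℂ) : ℝ≥0∞ :=
  reprENorm (IsSmoothAtom K d) s p q f

/-- `a` is a (non-smooth) `(σ,p)`-atom located at `Q_{j,m}`, with support in `d Q_{j,m}`; the space
`B^σ_p = B^σ_{p,p}` is built with `K`-atoms and dilation factor `d'`. -/
def IsNonsmoothAtom {n : ℕ} (K : ℕ) (d' σ : ℝ) (p : ℝ≥0∞) (d : ℝ) (j : ℕ) (m : Fin n → ℤ)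
    (a : E n → ℂ) : Prop :=
  MemBesov K d' σ p p a ∧ tsupport a ⊆ cube d j m ∧
    besovENorm K d' σ p p (fun x => a ((2 : ℝ) ^ (-(j : ℤ)) • x)) ≤ 1

end

end AtomicBesov

/-! Both implications convert representations by one class of atoms into representations by another,
with control of the sequence norm (`Refines`). One regrouping principle, `refines_of_decomposes`,
carries every conversion that is not a mere inclusion. Suppose each atom at $Q_{j,m}$ is itself a
sum over $l\ge 0$ of smooth atoms at levels $j+l$ near $Q_{j,m}$, whose coefficients at level $j+l$
have $\ell_p$ norm at most $A\,2^{-l(\tau-n/p)}$ with $\tau>s$. Inserting these sums and collecting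
terms by $k=j+l$ turns the coefficient estimate into a discrete convolution with a kernel decaying
like a power of $2^{-(\tau-s)l}$, which is bounded on $b^s_{p,q}$. The $J$-th partial sums before
and after differ only by the tails beyond $J-j$ of the decompositions at the levels $j<J$. These
have size $2^{-js}2^{-(J-j)\tau}$ and add up to $O(2^{-Js})$, so $s>0$ gives convergence in $L_p$.

Two decompositions are used. For a $(\sigma,p)$-atom, a nearly optimal representation of
$a(2^{-j}\cdot)$ in $\mathbf B^\sigma_p$ is multiplied by a cutoff and scaled back; this gives
$\tau=\sigma$ (`exists_decomposes_of_isNonsmoothAtom`). For a smooth $K$-atom, let $P$ be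
mollification at scale $2^{-(j+l)}$. Then $1-(1-P)^K$ approximates the atom with error $O(2^{-lK})$,
and successive differences are cut up by a partition of unity into about $2^{ln}$ pieces of size
$2^{-lK}$. This gives $\tau=K$ (`exists_decomposes_of_isSmoothAtom`); as $K\ge 1+[s]>s$, the
smoothness and dilation parameters may be changed freely, down to dilation factor $1$.

Finally, a smooth atom with $K_2$ derivatives and dilation factor $\min(d,d_2)$ is a
$(\sigma,p)$-atom, because its rescaling to level $0$ represents itself with coefficient $1$. The
theorem follows by composing these conversions. Since $p,q<1$ are allowed, sums over levels are
always estimated by giving up part of a geometric decay, and sums over $m$ by bounded overlap. -/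

namespace AtomicBesov

/-! ### Quasi-norms $\ell_p$ and geometric weights -/

section SequenceNorms

variable {ι κ : Type} {p q : ℝ≥0∞}

theorem ellENorm_top (c : ι → ℝ≥0∞) : ellENorm ∞ c = ⨆ i, c i := if_pos rfl

theorem ellENorm_of_ne_top (hp : p ≠ ∞) (c : ι → ℝ≥0∞) :
    ellENorm p c = (∑' i, c i ^ p.toReal) ^ (1 / p.toReal) := if_neg hp

theorem ellENorm_one (c : ι → ℝ≥0∞) : ellENorm 1 c = ∑' i, c i := by
  simp [ellENorm_of_ne_top ENNReal.one_ne_top]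

theorem ellENorm_mono {c d : ι → ℝ≥0∞} (h : ∀ i, c i ≤ d i) : ellENorm p c ≤ ellENorm p d := by
  by_cases hp : p = ∞
  · subst hp
    rw [ellENorm_top, ellENorm_top]
    exact iSup_mono h
  · rw [ellENorm_of_ne_top hp, ellENorm_of_ne_top hp]
    gcongr with i
    exact h i

theorem ellENorm_const_mul (hp : 0 < p) (A : ℝ≥0∞) (c : ι → ℝ≥0∞) :
    ellENorm p (fun i => A * c i) = A * ellENorm p c := by
  by_cases hp' : p = ∞
  · subst hp'
    rw [ellENorm_top, ellENorm_top, ENNReal.mul_iSup]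
  · have h0 : 0 < p.toReal := ENNReal.toReal_pos hp.ne' hp'
    rw [ellENorm_of_ne_top hp', ellENorm_of_ne_top hp']
    simp_rw [ENNReal.mul_rpow_of_nonneg _ _ h0.le]
    rw [ENNReal.tsum_mul_left, ENNReal.mul_rpow_of_nonneg _ _ (by positivity), ← ENNReal.rpow_mul,
      mul_one_div_cancel h0.ne', ENNReal.rpow_one]

theorem le_ellENorm (hp : 0 < p) (c : ι → ℝ≥0∞) (i : ι) : c i ≤ ellENorm p c := by
  by_cases hp' : p = ∞
  · subst hp'
    rw [ellENorm_top]
    exact le_iSup c i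
  · have h0 : 0 < p.toReal := ENNReal.toReal_pos hp.ne' hp'
    rw [ellENorm_of_ne_top hp', one_div]
    exact (ENNReal.le_rpow_inv_iff h0).2 (ENNReal.le_tsum i)

theorem ellENorm_comm (hp : 0 < p) (c : ι → κ → ℝ≥0∞) :
    ellENorm p (fun i => ellENorm p fun k => c i k) =
      ellENorm p (fun k => ellENorm p fun i => c i k) := by
  by_cases hp' : p = ∞
  · subst hp'
    simp_rw [ellENorm_top]
    exact iSup_comm
  · have h0 : 0 < p.toReal := ENNReal.toReal_pos hp.ne' hp'
    simp_rw [ellENorm_of_ne_top hp', ← ENNReal.rpow_mul, one_div_mul_cancel h0.ne',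
      ENNReal.rpow_one]
    rw [ENNReal.tsum_comm]

theorem sum_le_card_mul_ellENorm (hp : 0 < p) (S : Finset ι) (c : ι → ℝ≥0∞) :
    ∑ i ∈ S, c i ≤ S.card * ellENorm p c := by
  simpa using S.sum_le_card_nsmul c _ fun i _ => le_ellENorm hp c i

theorem ellENorm_indicator_le (hp : 0 < p) (S : Finset ι) (A : ℝ≥0∞) (c : ι → ℝ≥0∞)
    (h : ∀ i ∈ S, c i ≤ A) (h' : ∀ i ∉ S, c i = 0) :
    ellENorm p c ≤ A * (S.card : ℝ≥0∞) ^ (1 / p.toReal) := by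
  by_cases hp' : p = ∞
  · subst hp'
    simp only [ellENorm_top, ENNReal.toReal_top, div_zero, ENNReal.rpow_zero, mul_one]
    refine iSup_le fun i => ?_
    by_cases hi : i ∈ S
    · exact h i hi
    · simp [h' i hi]
  · have h0 : 0 < p.toReal := ENNReal.toReal_pos hp.ne' hp'
    rw [ellENorm_of_ne_top hp', tsum_eq_sum (s := S)
      fun i hi => by rw [h' i hi, ENNReal.zero_rpow_of_pos h0]]
    calc (∑ i ∈ S, c i ^ p.toReal) ^ (1 / p.toReal)
        ≤ (S.card * A ^ p.toReal) ^ (1 / p.toReal) := by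
          gcongr
          simpa using S.sum_le_card_nsmul _ (A ^ p.toReal) fun i hi =>
            ENNReal.rpow_le_rpow (h i hi) h0.le
      _ = A * (S.card : ℝ≥0∞) ^ (1 / p.toReal) := by
          rw [ENNReal.mul_rpow_of_nonneg _ _ (by positivity), ← ENNReal.rpow_mul,
            mul_one_div_cancel h0.ne', ENNReal.rpow_one, mul_comm]

theorem two_rpow_add (s t : ℝ) : (2 : ℝ≥0∞) ^ (s + t) = 2 ^ s * 2 ^ t :=
  ENNReal.rpow_add s t two_ne_zero ENNReal.ofNat_ne_top

theorem two_rpow_ne_top (s : ℝ) : (2 : ℝ≥0∞) ^ s ≠ ∞ :=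
  ENNReal.rpow_ne_top_of_ne_zero two_ne_zero ENNReal.ofNat_ne_top

/-- The `ℓ_p` quasi-norm of a geometric sequence with ratio `2^{-δ}`. -/
noncomputable def geomConst (p : ℝ≥0∞) (δ : ℝ) : ℝ≥0∞ :=
  ellENorm p fun i : ℕ => (2 : ℝ≥0∞) ^ (-δ * i)

theorem geomConst_ne_top (hp : 0 < p) {δ : ℝ} (hδ : 0 < δ) : geomConst p δ ≠ ∞ := by
  unfold geomConst
  by_cases hp' : p = ∞
  · subst hp'
    rw [ellENorm_top]
    refine ne_top_of_le_ne_top ENNReal.one_ne_top (iSup_le fun i => ?_)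
    calc (2 : ℝ≥0∞) ^ (-δ * i) ≤ 2 ^ (0 : ℝ) :=
          ENNReal.rpow_le_rpow_of_exponent_le (by norm_num)
            (mul_nonpos_of_nonpos_of_nonneg (by linarith) i.cast_nonneg)
      _ = 1 := ENNReal.rpow_zero
  · have h0 : 0 < p.toReal := ENNReal.toReal_pos hp.ne' hp'
    rw [ellENorm_of_ne_top hp']
    refine ENNReal.rpow_ne_top_of_nonneg (by positivity) ?_
    have : ∀ i : ℕ, ((2 : ℝ≥0∞) ^ (-δ * i)) ^ p.toReal = ((2 : ℝ≥0∞) ^ (-(δ * p.toReal))) ^ i := by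
      intro i
      rw [← ENNReal.rpow_mul, ← ENNReal.rpow_natCast, ← ENNReal.rpow_mul]
      ring_nf
    simp_rw [this]
    rw [ENNReal.tsum_geometric]
    refine ENNReal.inv_ne_top.2 (tsub_pos_of_lt ?_).ne'
    exact ENNReal.rpow_lt_one_of_one_lt_of_neg (by norm_num) (by nlinarith)

theorem ellENorm_geom_mul_le (hp : 0 < p) (δ : ℝ) {c : ℕ → ℝ≥0∞} {B : ℝ≥0∞} (h : ∀ i, c i ≤ B) :
    ellENorm p (fun i : ℕ => (2 : ℝ≥0∞) ^ (-δ * i) * c i) ≤ geomConst p δ * B := by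
  rw [mul_comm, geomConst, ← ellENorm_const_mul hp]
  refine ellENorm_mono fun i => ?_
  rw [mul_comm]
  gcongr
  exact h i

/-- A substitute for Hölder's inequality that is uniform in $0<p\le\infty$: each weighted term is at
most its $\ell_p$ norm, and the inverse weights are summable when $\varepsilon>0$. -/
theorem tsum_le_geom_mul_ellENorm (hp : 0 < p) (ε : ℝ) (c : ℕ → ℝ≥0∞) :
    ∑' i, c i ≤ geomConst 1 ε * ellENorm p (fun i : ℕ => (2 : ℝ≥0∞) ^ (ε * i) * c i) := by
  rw [← ellENorm_one]
  refine le_trans (ellENorm_mono fun i => ?_) (ellENorm_geom_mul_le one_pos ε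
    (c := fun i : ℕ => (2 : ℝ≥0∞) ^ (ε * i) * c i) fun i => le_ellENorm hp _ i)
  rw [← mul_assoc, ← two_rpow_add]
  simp

/-- A discrete form of Young's inequality for geometrically decaying kernels. -/
theorem ellENorm_convolution_le (hp : 0 < p) (hq : 0 < q) (δ : ℝ) (X : ℕ → ℝ≥0∞) :
    ellENorm q (fun k : ℕ => ellENorm p fun i : ℕ =>
        (2 : ℝ≥0∞) ^ (-δ * i) * if i ≤ k then X (k - i) else 0) ≤
      geomConst p (δ / 2) * geomConst q (δ / 2) * ellENorm q X := by
  set Y : ℕ → ℕ → ℝ≥0∞ := fun k i => if i ≤ k then X (k - i) else 0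
  -- Half of the decay replaces the inner $\ell_p$ by $\ell_q$, so that the two $\ell_q$ norms can
  -- be interchanged; the other half then sums the shifts of `X`.
  have h1 (k : ℕ) : ellENorm p (fun i : ℕ => (2 : ℝ≥0∞) ^ (-δ * i) * Y k i) ≤
      geomConst p (δ / 2) * ellENorm q (fun i : ℕ => (2 : ℝ≥0∞) ^ (-(δ / 2) * i) * Y k i) := by
    refine le_trans (ellENorm_mono fun i => ?_) (ellENorm_geom_mul_le hp (δ / 2)
      (c := fun i : ℕ => (2 : ℝ≥0∞) ^ (-(δ / 2) * i) * Y k i) fun i => le_ellENorm hq _ i)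
    rw [← mul_assoc, ← two_rpow_add]
    apply le_of_eq
    ring_nf
  have h2 (i : ℕ) : ellENorm q (fun k => Y k i) ≤ ellENorm q X := by
    by_cases hq' : q = ∞
    · subst hq'
      rw [ellENorm_top]
      refine iSup_le fun k => ?_
      simp only [Y]
      split_ifs
      · exact le_ellENorm hq X _
      · exact zero_le
    · have h0 : 0 < q.toReal := ENNReal.toReal_pos hq.ne' hq'
      rw [ellENorm_of_ne_top hq', ellENorm_of_ne_top hq']
      refine ENNReal.rpow_le_rpow ?_ (by positivity)
      rw [← Summable.sum_add_tsum_nat_add' (k := i) ENNReal.summable]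
      apply le_of_eq
      rw [Finset.sum_eq_zero, zero_add]
      · simp [Y]
      · intro k hk
        simp [Y, Finset.mem_range.1 hk, h0]
  calc _ ≤ ellENorm q (fun k => geomConst p (δ / 2) *
        ellENorm q (fun i : ℕ => (2 : ℝ≥0∞) ^ (-(δ / 2) * i) * Y k i)) := ellENorm_mono h1
    _ = geomConst p (δ / 2) * ellENorm q (fun i : ℕ => (2 : ℝ≥0∞) ^ (-(δ / 2) * i) *
        ellENorm q fun k => Y k i) := by
      rw [ellENorm_const_mul hq, ellENorm_comm hq]
      simp_rw [ellENorm_const_mul hq]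
    _ ≤ _ := by
      rw [mul_assoc]
      gcongr
      exact ellENorm_geom_mul_le hq _ h2

end SequenceNorms

/-! ### $L_p$ estimates valid for $0<p\le\infty$ -/

section LpEstimates

variable {ι α : Type} [MeasurableSpace α] {μ : Measure α} {p : ℝ≥0∞}

/-- The mixed norms $L_p(\ell_p)$ and $\ell_p(L_p)$ coincide, so a pointwise $\ell_p$ bound passes
to norms without loss and without a triangle inequality. -/
theorem eLpNorm_le_ellENorm [Countable ι] (hp : 0 < p) {C : ℝ≥0∞} {w : ι → ℝ≥0∞}
    {g : ι → α → ℂ} (hg : ∀ i, AEStronglyMeasurable (g i) μ) {F : α → ℂ}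
    (h : ∀ x, ‖F x‖ₑ ≤ C * ellENorm p fun i => w i * ‖g i x‖ₑ) :
    eLpNorm F p μ ≤ C * ellENorm p fun i => w i * eLpNorm (g i) p μ := by
  by_cases hp' : p = ∞
  · subst hp'
    simp only [eLpNorm_exponent_top, ellENorm_top] at h ⊢
    refine essSup_le_of_ae_le _ ?_
    have : ∀ᵐ x ∂μ, ∀ i, ‖g i x‖ₑ ≤ eLpNormEssSup (g i) μ :=
      ae_all_iff.2 fun i => enorm_ae_le_eLpNormEssSup (g i) μ
    filter_upwards [this] with x hx
    refine (h x).trans ?_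
    gcongr with i
    exact hx i
  · have h0 : 0 < p.toReal := ENNReal.toReal_pos hp.ne' hp'
    rw [ellENorm_of_ne_top hp']
    simp only [ellENorm_of_ne_top hp', eLpNorm_eq_lintegral_rpow_enorm_toReal hp.ne' hp'] at h ⊢
    calc (∫⁻ x, ‖F x‖ₑ ^ p.toReal ∂μ) ^ (1 / p.toReal)
        ≤ (∫⁻ x, C ^ p.toReal * ∑' i, w i ^ p.toReal * ‖g i x‖ₑ ^ p.toReal ∂μ) ^
            (1 / p.toReal) := by
          gcongr with x
          refine (ENNReal.rpow_le_rpow (h x) h0.le).trans (le_of_eq ?_)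
          rw [ENNReal.mul_rpow_of_nonneg _ _ h0.le, ← ENNReal.rpow_mul,
            one_div_mul_cancel h0.ne', ENNReal.rpow_one]
          simp_rw [ENNReal.mul_rpow_of_nonneg _ _ h0.le]
      _ = (C ^ p.toReal * ∑' i, w i ^ p.toReal * ∫⁻ x, ‖g i x‖ₑ ^ p.toReal ∂μ) ^
            (1 / p.toReal) := by
          have hm (i : ι) : AEMeasurable (fun x => ‖g i x‖ₑ ^ p.toReal) μ :=
            (hg i).enorm.pow_const _
          rw [lintegral_const_mul'' _ (AEMeasurable.tsum fun i => (hm i).const_mul _),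
            lintegral_tsum fun i => (hm i).const_mul _]
          simp_rw [fun i => lintegral_const_mul'' (w i ^ p.toReal) (hm i)]
      _ = _ := by
          rw [ENNReal.mul_rpow_of_nonneg _ _ (by positivity), ← ENNReal.rpow_mul,
            mul_one_div_cancel h0.ne', ENNReal.rpow_one]
          simp_rw [ENNReal.mul_rpow_of_nonneg _ _ h0.le, ← ENNReal.rpow_mul,
            one_div_mul_cancel h0.ne', ENNReal.rpow_one]

/-- Iterating the quasi-triangle inequality would give constants growing with `N`. Half of the decay
is spent instead on passing pointwise from $\ell_1$ to $\ell_p$. -/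
theorem eLpNorm_sum_le_of_geometric (hp : 0 < p) {δ : ℝ} {N : ℕ} {g : ℕ → α → ℂ}
    (hg : ∀ i < N, AEStronglyMeasurable (g i) μ) {B : ℝ≥0∞}
    (h : ∀ i < N, eLpNorm (g i) p μ ≤ 2 ^ (-δ * i) * B) :
    eLpNorm (fun x => ∑ i ∈ Finset.range N, g i x) p μ ≤
      geomConst 1 (δ / 2) * geomConst p (δ / 2) * B := by
  set g' : ℕ → α → ℂ := fun i => if i < N then g i else 0
  have hg' (i : ℕ) : AEStronglyMeasurable (g' i) μ := by
    simp only [g']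
    split_ifs with hi
    · exact hg i hi
    · exact aestronglyMeasurable_zero
  have h' (i : ℕ) : eLpNorm (g' i) p μ ≤ 2 ^ (-δ * i) * B := by
    simp only [g']
    split_ifs with hi
    · exact h i hi
    · simp
  have h1 (x : α) : ‖∑ i ∈ Finset.range N, g i x‖ₑ ≤
      geomConst 1 (δ / 2) * ellENorm p fun i : ℕ => 2 ^ (δ / 2 * i) * ‖g' i x‖ₑ := by
    refine le_trans ?_ (tsum_le_geom_mul_ellENorm hp (δ / 2) _)
    refine (enorm_sum_le _ _).trans ?_
    refine le_trans (le_of_eq (Finset.sum_congr rfl fun i hi => ?_))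
      (ENNReal.sum_le_tsum (Finset.range N))
    simp [g', Finset.mem_range.1 hi]
  refine (eLpNorm_le_ellENorm hp hg' h1).trans ?_
  rw [mul_assoc]
  gcongr
  refine le_trans (ellENorm_mono fun i => ?_)
    (ellENorm_geom_mul_le hp (δ / 2) (c := fun _ => B) fun _ => le_rfl)
  calc _ ≤ (2 : ℝ≥0∞) ^ (δ / 2 * i) * (2 ^ (-δ * i) * B) := by gcongr; exact h' i
    _ = _ := by
      rw [← mul_assoc, ← two_rpow_add]
      ring_nf

end LpEstimates

/-! ### Counting integer points in cubes -/

section IntegerPoints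

variable {n : ℕ}

/-- The integer points at `ℓ_∞`-distance at most `D` from `y`. -/
noncomputable def intPoints (y : Fin n → ℝ) (D : ℝ) : Finset (Fin n → ℤ) :=
  Fintype.piFinset fun i => Finset.Icc ⌈y i - D⌉ ⌊y i + D⌋

theorem mem_intPoints {y : Fin n → ℝ} {D : ℝ} {m : Fin n → ℤ} :
    m ∈ intPoints y D ↔ ∀ i, |y i - m i| ≤ D := by
  simp only [intPoints, Fintype.mem_piFinset, Finset.mem_Icc, Int.ceil_le, Int.le_floor, abs_le]
  refine forall_congr' fun i => ⟨fun h => ⟨?_, ?_⟩, fun h => ⟨?_, ?_⟩⟩ <;> linarith [h.1, h.2]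

theorem card_intPoints_le (y : Fin n → ℝ) {D : ℝ} (hD : 0 ≤ D) :
    ((intPoints y D).card : ℝ) ≤ (2 * D + 1) ^ n := by
  rw [intPoints, Fintype.card_piFinset]
  push_cast
  calc ∏ i : Fin n, ((Finset.Icc ⌈y i - D⌉ ⌊y i + D⌋).card : ℝ)
      ≤ ∏ _i : Fin n, (2 * D + 1) := by
        refine Finset.prod_le_prod (fun _ _ => by positivity) fun i _ => ?_
        rw [Int.card_Icc]
        have h1 := Int.floor_le (y i + D)
        have h2 := Int.le_ceil (y i - D)
        rcases le_total 0 (⌊y i + D⌋ + 1 - ⌈y i - D⌉) with h | h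
        · have : (((⌊y i + D⌋ + 1 - ⌈y i - D⌉).toNat : ℤ) : ℝ) =
              (⌊y i + D⌋ + 1 - ⌈y i - D⌉ : ℤ) := by rw [Int.toNat_of_nonneg h]
          rw [Int.cast_natCast] at this
          rw [this]
          push_cast
          linarith
        · rw [Int.toNat_of_nonpos h]
          simp only [Nat.cast_zero]
          linarith
    _ = (2 * D + 1) ^ n := by simp

/-- A bound for the number of integer points in a cube of half side `D`. -/
noncomputable def cardBound (n : ℕ) (D : ℝ) : ℝ≥0∞ := ENNReal.ofReal ((2 * D + 1) ^ n)

theorem cardBound_ne_top {D : ℝ} : cardBound n D ≠ ∞ := ENNReal.ofReal_ne_top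

theorem card_intPoints_le_cardBound (y : Fin n → ℝ) {D : ℝ} (hD : 0 ≤ D) :
    ((intPoints y D).card : ℝ≥0∞) ≤ cardBound n D := by
  rw [cardBound, ← ENNReal.ofReal_natCast]
  exact ENNReal.ofReal_le_ofReal (card_intPoints_le y hD)

end IntegerPoints

/-! ### Bounded overlap of the cubes of one level -/

section Overlap

variable {n : ℕ} {p : ℝ≥0∞}

/-- Seen from a fixed `x`, the cubes of level `j` containing `x` are indexed by a finite set whose
size is bounded independently of `x` and `j`. -/
theorem mem_cube_iff {d : ℝ} {j : ℕ} {m : Fin n → ℤ} {x : E n} :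
    x ∈ cube d j m ↔ m ∈ intPoints (fun i => (2 : ℝ) ^ j * x i) d := by
  rw [mem_intPoints, cube, Set.mem_ofPred_eq]
  refine forall_congr' fun i => ?_
  have h2 : (0 : ℝ) < 2 ^ j := by positivity
  rw [zpow_neg, zpow_natCast, ← div_eq_mul_inv, le_div_iff₀ h2, ← abs_of_pos h2, ← abs_mul,
    abs_of_pos h2]
  congr! 2
  field_simp

variable {D : ℝ} {j : ℕ} {g : (Fin n → ℤ) → E n → ℂ}

theorem tsum_eq_sum_intPoints (hg : ∀ m x, g m x ≠ 0 → m ∈ intPoints (fun i => (2 : ℝ) ^ j * x i) D)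
    (c : (Fin n → ℤ) → ℂ) (x : E n) :
    ∑' m, c m * g m x = ∑ m ∈ intPoints (fun i => (2 : ℝ) ^ j * x i) D, c m * g m x :=
  tsum_eq_sum fun m hm => by
    rw [not_imp_comm.1 (hg m x) hm, mul_zero]

theorem aestronglyMeasurable_tsum_mul (hm : ∀ m, AEStronglyMeasurable (g m) volume)
    (c : (Fin n → ℤ) → ℂ) : AEStronglyMeasurable (fun x => ∑' m, c m * g m x) volume :=
  (AEMeasurable.tsum fun m => ((hm m).const_mul (c m)).aemeasurable).aestronglyMeasurable

/-- The `L_p` quasi-norm of a sum of functions with bounded overlap. -/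
theorem eLpNorm_tsum_mul_le (hp : 0 < p) (hD : 0 ≤ D)
    (hg : ∀ m x, g m x ≠ 0 → m ∈ intPoints (fun i => (2 : ℝ) ^ j * x i) D)
    (hm : ∀ m, AEStronglyMeasurable (g m) volume) {c : (Fin n → ℤ) → ℂ} {B : ℝ≥0∞}
    (hB : ∀ m, eLpNorm (g m) p volume ≤ B) :
    eLpNorm (fun x => ∑' m, c m * g m x) p volume ≤
      cardBound n D * B * ellENorm p fun m => ‖c m‖ₑ := by
  have h1 (x : E n) : ‖∑' m, c m * g m x‖ₑ ≤
      cardBound n D * ellENorm p fun m => ‖c m‖ₑ * ‖g m x‖ₑ := by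
    rw [tsum_eq_sum_intPoints hg]
    refine (enorm_sum_le _ _).trans ?_
    simp_rw [enorm_mul]
    refine (sum_le_card_mul_ellENorm hp _ _).trans ?_
    gcongr
    exact card_intPoints_le_cardBound _ hD
  refine (eLpNorm_le_ellENorm hp hm h1).trans ?_
  rw [mul_assoc]
  gcongr
  rw [← ellENorm_const_mul hp]
  refine ellENorm_mono fun m => ?_
  rw [mul_comm]
  gcongr
  exact hB m

theorem volume_cube_le (d : ℝ) (j : ℕ) (m : Fin n → ℤ) :
    volume (cube d j m) ≤ volume (cube d 0 (0 : Fin n → ℤ)) * 2 ^ (-((j : ℝ) * n)) := by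
  have : cube d j m = (fun x : E n => (2 : ℝ) ^ j • x +
      WithLp.toLp 2 fun i => (-(m i) : ℝ)) ⁻¹' cube d 0 (0 : Fin n → ℤ) := by
    ext x
    rw [mem_cube_iff, Set.mem_preimage, mem_cube_iff, mem_intPoints, mem_intPoints]
    simp [sub_eq_add_neg]
  rw [this, ← Function.comp_def (fun y : E n => y + WithLp.toLp 2 fun i => (-(m i) : ℝ)),
    Set.preimage_comp, Measure.addHaar_preimage_smul _ (by positivity), measure_preimage_add_right,
    mul_comm]
  gcongr
  rw [finrank_euclideanSpace_fin, abs_of_pos (by positivity), ← pow_mul, ENNReal.ofReal_inv_of_pos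
    (by positivity), ENNReal.rpow_neg, ← Nat.cast_mul, ENNReal.rpow_natCast,
    ENNReal.ofReal_pow (by norm_num)]
  simp

theorem isCompact_cube (d : ℝ) (j : ℕ) (m : Fin n → ℤ) : IsCompact (cube d j m) := by
  have : cube d j m = (EuclideanSpace.equiv (Fin n) ℝ).toHomeomorph ⁻¹' Set.univ.pi fun i =>
      Set.Icc ((2 : ℝ) ^ (-(j : ℤ)) * m i - d * (2 : ℝ) ^ (-(j : ℤ)))
        ((2 : ℝ) ^ (-(j : ℤ)) * m i + d * (2 : ℝ) ^ (-(j : ℤ))) := by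
    ext x
    simp only [cube, abs_le, Set.mem_ofPred_eq, Set.mem_preimage, Set.mem_pi, Set.mem_Icc,
      Set.mem_univ, true_imp_iff]
    refine forall_congr' fun i => ⟨fun h => ⟨?_, ?_⟩, fun h => ⟨?_, ?_⟩⟩ <;>
      simp at h ⊢ <;> linarith [h.1, h.2]
  rw [this]
  exact (Homeomorph.isCompact_preimage _).2 (isCompact_univ_pi fun i => isCompact_Icc)

theorem eLpNorm_le_of_support_subset_cube {d : ℝ} {j : ℕ} {m : Fin n → ℤ}
    {f : E n → ℂ} (hf : ∀ x ∉ cube d j m, f x = 0) {B : ℝ≥0∞} (hB : ∀ x, ‖f x‖ₑ ≤ B) :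
    eLpNorm f p volume ≤ B * volume (cube d 0 (0 : Fin n → ℤ)) ^ (1 / p.toReal) *
      2 ^ (-((j : ℝ) * (n / p.toReal))) := by
  have h1 : eLpNorm f p volume ≤ B * volume (cube d j m) ^ (1 / p.toReal) := by
    refine le_trans (eLpNorm_mono_enorm (g := (cube d j m).indicator fun _ => B) fun x => ?_) ?_
    · by_cases hx : x ∈ cube d j m
      · simpa [hx] using hB x
      · simp [hx, hf x hx]
    · exact eLpNorm_indicator_const_le _ _
  refine h1.trans ?_
  rw [mul_assoc]
  gcongr
  refine (ENNReal.rpow_le_rpow (volume_cube_le d j m) (by positivity)).trans (le_of_eq ?_)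
  rw [ENNReal.mul_rpow_of_nonneg _ _ (by positivity), ← ENNReal.rpow_mul]
  ring_nf

end Overlap

/-! ### Finite combinations of smooth atoms -/

section SmoothAtoms

variable {n K : ℕ} {d : ℝ} {j : ℕ} {m : Fin n → ℤ} {a : E n → ℂ}

theorem eq_zero_of_tsupport_subset {X : Type} [TopologicalSpace X] {f : X → ℂ} {s : Set X}
    (h : tsupport f ⊆ s) {x : X} (hx : x ∉ s) : f x = 0 :=
  image_eq_zero_of_notMem_tsupport fun hx' => hx (h hx')

theorem tsupport_subset_cube (h : ∀ x ∉ cube d j m, a x = 0) : tsupport a ⊆ cube d j m :=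
  closure_minimal (fun x hx => by_contra fun hx' => hx (h x hx')) (isCompact_cube d j m).isClosed

theorem IsSmoothAtom.norm_le (h : IsSmoothAtom K d j m a) (x : E n) : ‖a x‖ ≤ 1 := by
  simpa using h.2.2 0 (Nat.zero_le K) (fun i => i.elim0) x

theorem IsSmoothAtom.eq_zero (h : IsSmoothAtom K d j m a) {x : E n} (hx : x ∉ cube d j m) :
    a x = 0 :=
  eq_zero_of_tsupport_subset h.2.1 hx

theorem IsSmoothAtom.continuous (h : IsSmoothAtom K d j m a) : Continuous a := h.1.continuous

theorem isSmoothAtom_zero (K : ℕ) (d : ℝ) (j : ℕ) (m : Fin n → ℤ) :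
    IsSmoothAtom K d j m (fun _ => 0) := by
  refine ⟨contDiff_const, ?_, fun k _ v x => ?_⟩
  · exact tsupport_subset_cube fun _ _ => rfl
  · rw [iteratedFDeriv_fun_zero]
    simp

/-- A finite combination of atoms is the sum of the absolute values of the coefficients times
an atom. -/
theorem exists_isSmoothAtom_sum_eq {ι : Type} (T : Finset ι) (z : ι → ℂ) (b : ι → E n → ℂ)
    (hb : ∀ t ∈ T, IsSmoothAtom K d j m (b t)) :
    ∃ B, IsSmoothAtom K d j m B ∧
      ∀ x, ∑ t ∈ T, z t * b t x = ((∑ t ∈ T, ‖z t‖ : ℝ) : ℂ) * B x := by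
  set S : ℝ := ∑ t ∈ T, ‖z t‖
  have hS : 0 ≤ S := Finset.sum_nonneg fun _ _ => norm_nonneg _
  -- If the total weight is zero, all coefficients vanish and the zero atom serves; otherwise one
  -- divides by it.
  rcases hS.eq_or_lt' with h0 | h0
  · refine ⟨fun _ => 0, isSmoothAtom_zero K d j m, fun x => ?_⟩
    rw [mul_zero]
    refine Finset.sum_eq_zero fun t ht => ?_
    have := (Finset.sum_eq_zero_iff_of_nonneg fun _ _ => norm_nonneg _).1 h0 t ht
    rw [norm_eq_zero.1 this, zero_mul]
  · refine ⟨fun x => ∑ t ∈ T, (z t / S) • b t x, ⟨?_, ?_, ?_⟩, fun x => ?_⟩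
    · exact ContDiff.sum fun t ht => (hb t ht).1.const_smul (z t / (S : ℂ))
    · refine tsupport_subset_cube fun x hx => ?_
      refine Finset.sum_eq_zero fun t ht => ?_
      rw [(hb t ht).eq_zero hx, smul_zero]
    · intro k hk v x
      have hk' (t) (ht : t ∈ T) : ContDiff ℝ k (b t) := (hb t ht).1.of_le (by exact_mod_cast hk)
      rw [iteratedFDeriv_sum fun t ht => (hk' t ht).const_smul (z t / (S : ℂ)), Finset.sum_apply,
        _root_.sum_apply]
      calc _ ≤ ∑ t ∈ T, ‖z t‖ / S * 2 ^ (k * j) := by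
            refine norm_sum_le_of_le _ fun t ht => ?_
            rw [iteratedFDeriv_const_smul_apply' (hk' t ht).contDiffAt,
              _root_.smul_apply, norm_smul, norm_div, Complex.norm_real,
              Real.norm_of_nonneg hS]
            gcongr
            exact (hb t ht).2.2 k hk v x
        _ = 2 ^ (k * j) := by
            rw [← Finset.sum_mul, ← Finset.sum_div, div_self h0.ne', one_mul]
    · rw [Finset.mul_sum]
      refine Finset.sum_congr rfl fun t _ => ?_
      have : (S : ℂ) ≠ 0 := by exact_mod_cast h0.ne'
      rw [smul_eq_mul, ← mul_assoc, mul_div_cancel₀ _ this]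

end SmoothAtoms

/-! ### Conversion between classes of atoms -/

section Refinement

variable {n : ℕ}

/-- Every representation by functions in `Atom` can be converted into a representation by
functions in `Atom'`, with control of the sequence norms. -/
def Refines (Atom Atom' : ℕ → (Fin n → ℤ) → (E n → ℂ) → Prop) (s : ℝ) (p q : ℝ≥0∞) : Prop :=
  ∃ C : ℝ≥0, ∀ f : E n → ℂ, MemLp f p volume → ∀ c a, IsRepr Atom s p q f c a →
    ∃ c' a', IsRepr Atom' s p q f c' a' ∧ seqENorm s p q c' ≤ C * seqENorm s p q c

variable {Atom Atom' Atom'' : ℕ → (Fin n → ℤ) → (E n → ℂ) → Prop} {s : ℝ} {p q : ℝ≥0∞}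

theorem reprENorm_le {f : E n → ℂ} {c a} (h : IsRepr Atom s p q f c a) :
    reprENorm Atom s p q f ≤ seqENorm s p q c := by
  unfold reprENorm
  exact iInf_le_of_le c <| iInf_le_of_le a <| iInf_le _ h

theorem Refines.trans (h : Refines Atom Atom' s p q) (h' : Refines Atom' Atom'' s p q) :
    Refines Atom Atom'' s p q := by
  obtain ⟨C, hC⟩ := h
  obtain ⟨C', hC'⟩ := h'
  refine ⟨C' * C, fun f hf c a hr => ?_⟩
  obtain ⟨c', a', hr', hle⟩ := hC f hf c a hr
  obtain ⟨c'', a'', hr'', hle'⟩ := hC' f hf c' a' hr'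
  refine ⟨c'', a'', hr'', hle'.trans ?_⟩
  rw [ENNReal.coe_mul, mul_assoc]
  gcongr

theorem Refines.of_imp (h : ∀ j m a, Atom j m a → Atom' j m a) : Refines Atom Atom' s p q :=
  ⟨1, fun _ _ c a hr => ⟨c, a, ⟨fun j m => h j m _ (hr.1 j m), hr.2⟩, by simp⟩⟩

theorem Refines.exists_isRepr (h : Refines Atom Atom' s p q) {f : E n → ℂ}
    (hf : MemLp f p volume) (hr : ∃ c a, IsRepr Atom s p q f c a) :
    ∃ c a, IsRepr Atom' s p q f c a := by
  obtain ⟨C, hC⟩ := h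
  obtain ⟨c, a, hr⟩ := hr
  obtain ⟨c', a', hr', -⟩ := hC f hf c a hr
  exact ⟨c', a', hr'⟩

theorem Refines.exists_reprENorm_le (h : Refines Atom Atom' s p q) :
    ∃ C : ℝ≥0, 0 < C ∧ ∀ f : E n → ℂ, MemLp f p volume →
      reprENorm Atom' s p q f ≤ C * reprENorm Atom s p q f := by
  obtain ⟨C, hC⟩ := h
  -- Adding $1$ makes the constant nonzero, so that it can be moved to the other side before taking
  -- the infimum, which may be $\infty$.
  refine ⟨C + 1, by positivity, fun f hf => ?_⟩
  have h0 : ((C + 1 : ℝ≥0) : ℝ≥0∞) ≠ 0 := by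
    simp
  have hle : ((C + 1 : ℝ≥0) : ℝ≥0∞)⁻¹ * reprENorm Atom' s p q f ≤ reprENorm Atom s p q f := by
    refine le_iInf fun c => le_iInf fun a => le_iInf fun hr => ?_
    rw [ENNReal.inv_mul_le_iff h0 ENNReal.coe_ne_top]
    obtain ⟨c', a', hr', hle⟩ := hC f hf c a hr
    refine ((reprENorm_le hr').trans hle).trans ?_
    gcongr
    simp
  rwa [ENNReal.inv_mul_le_iff h0 ENNReal.coe_ne_top] at hle

end Refinement

/-! ### Decompositions of single atoms and their tails -/

section Decomposition

variable {n : ℕ}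

/-- `a`, located at `Q_{j,m}`, is a sum of smooth atoms at the levels `j + l`, `l ≥ 0`, which are
located near `Q_{j,m}`, with coefficients decaying like a sequence in `b^τ_{p,∞}`. -/
def Decomposes (K : ℕ) (d τ D : ℝ) (A p : ℝ≥0∞) (j : ℕ) (m : Fin n → ℤ) (a : E n → ℂ) : Prop :=
  ∃ (μ : ℕ → (Fin n → ℤ) → ℂ) (b : ℕ → (Fin n → ℤ) → E n → ℂ),
    (∀ l w, IsSmoothAtom K d (j + l) w (b l w)) ∧
    (∀ l w, μ l w ≠ 0 → ∀ i, |(w i : ℝ) / 2 ^ l - m i| ≤ D) ∧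
    (∀ l, ellENorm p (fun w => ‖μ l w‖ₑ) ≤ A * 2 ^ (-((l : ℝ) * (τ - n / p.toReal)))) ∧
    ConvergesInLp p a μ b

variable {K : ℕ} {d τ D : ℝ} {A p : ℝ≥0∞} {j : ℕ} {m : Fin n → ℤ} {a : E n → ℂ}
  {μ : ℕ → (Fin n → ℤ) → ℂ} {b : ℕ → (Fin n → ℤ) → E n → ℂ}

theorem IsSmoothAtom.eLpNorm_le (h : IsSmoothAtom K d j m a) :
    eLpNorm a p volume ≤ volume (cube d 0 (0 : Fin n → ℤ)) ^ (1 / p.toReal) *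
      2 ^ (-((j : ℝ) * (n / p.toReal))) := by
  refine (eLpNorm_le_of_support_subset_cube (fun x hx => h.eq_zero hx) (B := 1)
    fun x => ?_).trans_eq (by rw [one_mul])
  rw [← ofReal_norm, ENNReal.ofReal_le_one]
  exact h.norm_le x

theorem IsSmoothAtom.mem_intPoints (h : IsSmoothAtom K d j m a) {x : E n} (hx : a x ≠ 0) :
    m ∈ intPoints (fun i => (2 : ℝ) ^ j * x i) d :=
  mem_cube_iff.1 <| by_contra fun hx' => hx (h.eq_zero hx')

/-- The constant in the `L_p`-estimate of a sum of atoms at one level. -/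
noncomputable def levelConst (n : ℕ) (d : ℝ) (p : ℝ≥0∞) : ℝ≥0∞ :=
  cardBound n d * volume (cube d 0 (0 : Fin n → ℤ)) ^ (1 / p.toReal)

theorem levelConst_ne_top (n : ℕ) (d : ℝ) (p : ℝ≥0∞) : levelConst n d p ≠ ∞ :=
  ENNReal.mul_ne_top cardBound_ne_top
    (ENNReal.rpow_ne_top_of_nonneg (by positivity) (isCompact_cube d 0 0).measure_lt_top.ne)

theorem eLpNorm_level_le (hp : 0 < p) (hd : 0 ≤ d) {b : (Fin n → ℤ) → E n → ℂ}
    (hb : ∀ w, IsSmoothAtom K d j w (b w)) (c : (Fin n → ℤ) → ℂ) :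
    eLpNorm (fun x => ∑' w, c w * b w x) p volume ≤
      levelConst n d p * 2 ^ (-((j : ℝ) * (n / p.toReal))) * ellENorm p fun w => ‖c w‖ₑ := by
  refine (eLpNorm_tsum_mul_le hp hd (fun w x hx => (hb w).mem_intPoints hx)
    (fun w => (hb w).continuous.aestronglyMeasurable) fun w => (hb w).eLpNorm_le).trans_eq ?_
  rw [levelConst]
  ring

theorem aestronglyMeasurable_partialSum {c : ℕ → (Fin n → ℤ) → ℂ} {a : ℕ → (Fin n → ℤ) → E n → ℂ}
    (ha : ∀ j m, AEStronglyMeasurable (a j m) volume) (J : ℕ) :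
    AEStronglyMeasurable (partialSum c a J) volume :=
  Finset.aestronglyMeasurable_fun_sum _ fun j _ => aestronglyMeasurable_tsum_mul (ha j) (c j)

/-- The constant in the estimate of the tails of a decomposition. -/
noncomputable def tailConst (n : ℕ) (d τ : ℝ) (A p : ℝ≥0∞) : ℝ≥0∞ :=
  ENNReal.LpAddConst p * (geomConst 1 (τ / 2) * geomConst p (τ / 2) * (levelConst n d p * A))

theorem tailConst_ne_top (hp : 0 < p) (hτ : 0 < τ) (hA : A ≠ ∞) : tailConst n d τ A p ≠ ∞ := by
  refine ENNReal.mul_ne_top (ENNReal.LpAddConst_lt_top p).ne (ENNReal.mul_ne_top (ENNReal.mul_ne_top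
    (geomConst_ne_top one_pos (half_pos hτ)) (geomConst_ne_top hp (half_pos hτ)))
    (ENNReal.mul_ne_top (levelConst_ne_top n d p) hA))

/-- The assumed convergence has no rate. The rate comes from the coefficients: level $j+l$
contributes at most a multiple of $2^{-jn/p}2^{-l\tau}$, the powers $2^{\pm ln/p}$ from the atoms
and the coefficients cancelling. -/
theorem eLpNorm_tail_le (hp : 0 < p) (hd : 0 ≤ d) (ha : AEStronglyMeasurable a volume)
    (hb : ∀ l w, IsSmoothAtom K d (j + l) w (b l w))
    (hμ : ∀ l, ellENorm p (fun w => ‖μ l w‖ₑ) ≤ A * 2 ^ (-((l : ℝ) * (τ - n / p.toReal))))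
    (hconv : ConvergesInLp p a μ b) (L : ℕ) :
    eLpNorm (fun x => a x - partialSum μ b L x) p volume ≤
      tailConst n d τ A p * 2 ^ (-((j : ℝ) * (n / p.toReal))) * 2 ^ (-((L : ℝ) * τ)) := by
  have hbm (l : ℕ) (w) : AEStronglyMeasurable (b l w) volume :=
    (hb l w).continuous.aestronglyMeasurable
  set B : ℝ≥0∞ := levelConst n d p * A * 2 ^ (-((j : ℝ) * (n / p.toReal))) * 2 ^ (-((L : ℝ) * τ))
  have hlevel (i : ℕ) : eLpNorm (fun x => ∑' w, μ (L + i) w * b (L + i) w x) p volume ≤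
      2 ^ (-τ * i) * B := by
    refine (eLpNorm_level_le hp hd (hb (L + i)) _).trans ?_
    calc _ ≤ levelConst n d p * 2 ^ (-(((j + (L + i) : ℕ) : ℝ) * (n / p.toReal))) *
          (A * 2 ^ (-(((L + i : ℕ) : ℝ) * (τ - n / p.toReal)))) := by
          gcongr
          exact hμ _
      _ = levelConst n d p * A * (2 ^ (-(((j + (L + i) : ℕ) : ℝ) * (n / p.toReal))) *
            2 ^ (-(((L + i : ℕ) : ℝ) * (τ - n / p.toReal)))) := by ring
      _ = levelConst n d p * A * (2 ^ (-τ * i) *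
            (2 ^ (-((j : ℝ) * (n / p.toReal))) * 2 ^ (-((L : ℝ) * τ)))) := by
          rw [← two_rpow_add, ← two_rpow_add, ← two_rpow_add]
          push_cast
          ring_nf
      _ = _ := by ring
  have hsum (N : ℕ) :
      eLpNorm (fun x => ∑ i ∈ Finset.range N, ∑' w, μ (L + i) w * b (L + i) w x) p volume ≤
        geomConst 1 (τ / 2) * geomConst p (τ / 2) * B :=
    eLpNorm_sum_le_of_geometric (g := fun i x => ∑' w, μ (L + i) w * b (L + i) w x) hp
      (fun i _ => aestronglyMeasurable_tsum_mul (hbm _) _) fun i _ => hlevel i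
  -- The quasi-triangle inequality is used only once, with the intermediate index `M` free; letting
  -- `M` tend to infinity removes the remainder.
  have hM (M : ℕ) (hLM : L ≤ M) : eLpNorm (fun x => a x - partialSum μ b L x) p volume ≤
      ENNReal.LpAddConst p * (eLpNorm (fun x => a x - partialSum μ b M x) p volume +
        geomConst 1 (τ / 2) * geomConst p (τ / 2) * B) := by
    have h1 : (fun x => a x - partialSum μ b L x) = (fun x => a x - partialSum μ b M x) +
        fun x => ∑ i ∈ Finset.range (M - L), ∑' w, μ (L + i) w * b (L + i) w x := by
      ext x
      rw [Pi.add_apply, ← Finset.sum_Ico_eq_sum_range (fun l => ∑' w, μ l w * b l w x),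
        Finset.sum_Ico_eq_sub _ hLM]
      simp only [partialSum]
      ring
    rw [h1]
    have hm1 : AEStronglyMeasurable (fun x => a x - partialSum μ b M x) volume :=
      ha.sub (aestronglyMeasurable_partialSum hbm M)
    have hm2 : AEStronglyMeasurable
        (fun x => ∑ i ∈ Finset.range (M - L), ∑' w, μ (L + i) w * b (L + i) w x) volume :=
      Finset.aestronglyMeasurable_fun_sum _ fun i _ => aestronglyMeasurable_tsum_mul (hbm _) _
    refine (eLpNorm_add_le' hm1 hm2 p).trans ?_
    gcongr
    exact hsum _
  have hlim : Tendsto (fun M => ENNReal.LpAddConst p * (eLpNorm (fun x => a x - partialSum μ b M x) p volume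
      + geomConst 1 (τ / 2) * geomConst p (τ / 2) * B)) atTop
      (𝓝 (ENNReal.LpAddConst p * (0 + geomConst 1 (τ / 2) * geomConst p (τ / 2) * B))) :=
    ENNReal.Tendsto.const_mul (hconv.add tendsto_const_nhds) (Or.inr (ENNReal.LpAddConst_lt_top p).ne)
  refine (ge_of_tendsto hlim (eventually_atTop.2 ⟨L, hM⟩)).trans_eq ?_
  rw [tailConst, zero_add]
  ring

end Decomposition

/-! ### Regrouping by the levels of the new atoms -/

section Regrouping

variable {n K : ℕ} {s τ d D : ℝ} {A p q : ℝ≥0∞}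

/-- The coefficients that arise when decompositions of the terms of a series are collected by the
levels of the new atoms. -/
noncomputable def regroupedCoeff (D : ℝ) (c : ℕ → (Fin n → ℤ) → ℂ)
    (μ : ℕ → (Fin n → ℤ) → ℕ → (Fin n → ℤ) → ℂ) (k : ℕ) (w : Fin n → ℤ) : ℝ :=
  ∑ i ∈ Finset.range (k + 1), ∑ m ∈ intPoints (fun t => (w t : ℝ) / 2 ^ i) D,
    ‖c (k - i) m * μ (k - i) m i w‖

/-- The constant in the estimate of the regrouped coefficients. -/
noncomputable def regroupConst (n : ℕ) (s τ D : ℝ) (A p q : ℝ≥0∞) : ℝ≥0∞ :=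
  cardBound n D * geomConst 1 ((τ - s) / 2) * A *
    (geomConst p ((τ - s) / 2 / 2) * geomConst q ((τ - s) / 2 / 2))

theorem regroupConst_ne_top (hp : 0 < p) (hq : 0 < q) (h : s < τ) (hA : A ≠ ∞) :
    regroupConst n s τ D A p q ≠ ∞ := by
  have h1 : 0 < (τ - s) / 2 := by linarith
  have h2 : 0 < (τ - s) / 2 / 2 := by linarith
  exact ENNReal.mul_ne_top (ENNReal.mul_ne_top (ENNReal.mul_ne_top cardBound_ne_top
    (geomConst_ne_top one_pos h1)) hA)
    (ENNReal.mul_ne_top (geomConst_ne_top hp h2) (geomConst_ne_top hq h2))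

theorem seqENorm_regroupedCoeff_le (hp : 0 < p) (hq : 0 < q) (hD : 0 ≤ D)
    (c : ℕ → (Fin n → ℤ) → ℂ) {μ : ℕ → (Fin n → ℤ) → ℕ → (Fin n → ℤ) → ℂ}
    (hμ : ∀ j m l, ellENorm p (fun w => ‖μ j m l w‖ₑ) ≤
      A * 2 ^ (-((l : ℝ) * (τ - n / p.toReal)))) :
    seqENorm s p q (fun k w => (regroupedCoeff D c μ k w : ℂ)) ≤
      regroupConst n s τ D A p q * seqENorm s p q c := by
  -- Half of the gap pays for replacing the sum over `i` by an $\ell_p$ norm; the factor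
  -- $2^{-\varepsilon i}$ that is left is the convolution kernel.
  set ε : ℝ := (τ - s) / 2 with hε
  set X : ℕ → ℝ≥0∞ := fun j =>
    (2 : ℝ≥0∞) ^ ((j : ℝ) * (s - n / p.toReal)) * ellENorm p fun m => ‖c j m‖ₑ
  have hk (k : ℕ) : (2 : ℝ≥0∞) ^ ((k : ℝ) * (s - n / p.toReal)) *
      ellENorm p (fun w => ‖(regroupedCoeff D c μ k w : ℂ)‖ₑ) ≤
      cardBound n D * geomConst 1 ε * A *
        ellENorm p (fun i : ℕ => (2 : ℝ≥0∞) ^ (-ε * i) * if i ≤ k then X (k - i) else 0) := by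
    set x : ℕ → (Fin n → ℤ) → ℝ≥0∞ := fun i w =>
      if i ≤ k then ellENorm p fun m => ‖c (k - i) m‖ₑ * ‖μ (k - i) m i w‖ₑ else 0
    have h1 (w : Fin n → ℤ) : ‖(regroupedCoeff D c μ k w : ℂ)‖ₑ ≤
        cardBound n D * (geomConst 1 ε *
          ellENorm p fun i : ℕ => (2 : ℝ≥0∞) ^ (ε * i) * x i w) := by
      refine le_trans ?_ (mul_le_mul_right (tsum_le_geom_mul_ellENorm hp ε _) _)
      calc ‖(regroupedCoeff D c μ k w : ℂ)‖ₑ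
          ≤ ∑ i ∈ Finset.range (k + 1), ∑ m ∈ intPoints (fun t => (w t : ℝ) / 2 ^ i) D,
              ‖c (k - i) m‖ₑ * ‖μ (k - i) m i w‖ₑ := by
            rw [regroupedCoeff]
            push_cast
            refine (enorm_sum_le _ _).trans (Finset.sum_le_sum fun i _ => ?_)
            refine (enorm_sum_le _ _).trans (Finset.sum_le_sum fun m _ => ?_)
            rw [← enorm_mul, ← ofReal_norm, ← ofReal_norm, Complex.norm_real, norm_norm]
        _ ≤ ∑ i ∈ Finset.range (k + 1), cardBound n D * x i w := by
            refine Finset.sum_le_sum fun i hi => ?_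
            refine (sum_le_card_mul_ellENorm hp _ _).trans ?_
            simp only [x, if_pos (Nat.lt_succ_iff.1 (Finset.mem_range.1 hi))]
            gcongr
            exact card_intPoints_le_cardBound _ hD
        _ ≤ cardBound n D * ∑' i, x i w := by
            rw [← Finset.mul_sum]
            gcongr
            exact ENNReal.sum_le_tsum _
    have h2 (i : ℕ) : ellENorm p (fun w => x i w) ≤ if i ≤ k then
        A * 2 ^ (-((i : ℝ) * (τ - n / p.toReal))) * ellENorm p (fun m => ‖c (k - i) m‖ₑ) else 0 := by
      by_cases hi : i ≤ k
      · simp only [x, if_pos hi]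
        rw [ellENorm_comm hp, ← ellENorm_const_mul hp]
        refine ellENorm_mono fun m => ?_
        rw [ellENorm_const_mul hp, mul_comm]
        gcongr
        exact hμ _ _ _
      · simp only [x, if_neg hi]
        simpa using (ellENorm_const_mul hp 0 fun _ : Fin n → ℤ => 0).le
    calc _ ≤ (2 : ℝ≥0∞) ^ ((k : ℝ) * (s - n / p.toReal)) * (cardBound n D * (geomConst 1 ε *
          ellENorm p fun i : ℕ => (2 : ℝ≥0∞) ^ (ε * i) * ellENorm p (fun w => x i w))) := by
          gcongr
          refine (ellENorm_mono h1).trans (le_of_eq ?_)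
          rw [ellENorm_const_mul hp, ellENorm_const_mul hp, ellENorm_comm hp]
          simp_rw [ellENorm_const_mul hp]
      _ = cardBound n D * geomConst 1 ε * ellENorm p fun i : ℕ =>
          (2 : ℝ≥0∞) ^ ((k : ℝ) * (s - n / p.toReal)) * ((2 : ℝ≥0∞) ^ (ε * i) *
            ellENorm p (fun w => x i w)) := by
          rw [ellENorm_const_mul hp]
          ring
      _ ≤ _ := by
          rw [mul_assoc _ A, ← ellENorm_const_mul hp A]
          refine mul_le_mul_right (ellENorm_mono fun i => ?_) _
          refine (mul_le_mul_right (mul_le_mul_right (h2 i) _) _).trans (le_of_eq ?_)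
          split_ifs with hi
          · simp only [X]
            have e1 : (2 : ℝ≥0∞) ^ ((k : ℝ) * (s - n / p.toReal)) * (2 : ℝ≥0∞) ^ (ε * i) *
                2 ^ (-((i : ℝ) * (τ - n / p.toReal))) = (2 : ℝ≥0∞) ^ (-ε * i) *
                  (2 : ℝ≥0∞) ^ (((k - i : ℕ) : ℝ) * (s - n / p.toReal)) := by
              rw [← two_rpow_add, ← two_rpow_add, ← two_rpow_add, Nat.cast_sub hi, hε]
              ring_nf
            calc _ = A * ((2 : ℝ≥0∞) ^ ((k : ℝ) * (s - n / p.toReal)) * (2 : ℝ≥0∞) ^ (ε * i) *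
                2 ^ (-((i : ℝ) * (τ - n / p.toReal)))) * ellENorm p fun m => ‖c (k - i) m‖ₑ := by
                  ring
              _ = _ := by
                  rw [e1]
                  ring
          · simp
  calc seqENorm s p q (fun k w => (regroupedCoeff D c μ k w : ℂ))
      ≤ ellENorm q fun k => cardBound n D * geomConst 1 ε * A *
        ellENorm p (fun i : ℕ => (2 : ℝ≥0∞) ^ (-ε * i) * if i ≤ k then X (k - i) else 0) :=
        ellENorm_mono hk
    _ ≤ _ := by
        rw [ellENorm_const_mul hq, regroupConst, mul_assoc (cardBound n D * _ * A)]
        gcongr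
        exact ellENorm_convolution_le hp hq ε X

/-- Bounded overlap survives decomposition: the fine atoms descending from $Q_{j,m}$ stay in a fixed
multiple of it, whatever `l` is. -/
theorem mem_intPoints_of_near (hd : 0 ≤ d) {j l : ℕ} {m w : Fin n → ℤ} {x : E n}
    (hw : w ∈ intPoints (fun i => (2 : ℝ) ^ (j + l) * x i) d)
    (h : ∀ i, |(w i : ℝ) / 2 ^ l - m i| ≤ D) :
    m ∈ intPoints (fun i => (2 : ℝ) ^ j * x i) (D + d) := by
  rw [mem_intPoints] at hw ⊢
  intro i
  have h2 : (1 : ℝ) ≤ 2 ^ l := one_le_pow₀ one_le_two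
  have h1 : |(2 : ℝ) ^ j * x i - w i / 2 ^ l| ≤ d := by
    have : (2 : ℝ) ^ j * x i - w i / 2 ^ l = ((2 : ℝ) ^ (j + l) * x i - w i) / 2 ^ l := by
      rw [pow_add]
      field_simp
    rw [this, abs_div, abs_of_pos (by positivity : (0 : ℝ) < 2 ^ l), div_le_iff₀ (by positivity)]
    nlinarith [hw i]
  calc |(2 : ℝ) ^ j * x i - m i| ≤ |(2 : ℝ) ^ j * x i - w i / 2 ^ l| + |(w i : ℝ) / 2 ^ l - m i| :=
        abs_sub_le _ _ _
    _ ≤ D + d := by linarith [h i]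

variable {c : ℕ → (Fin n → ℤ) → ℂ} {μ : ℕ → (Fin n → ℤ) → ℕ → (Fin n → ℤ) → ℂ}
  {b : ℕ → (Fin n → ℤ) → ℕ → (Fin n → ℤ) → E n → ℂ}

theorem partialSum_ne_zero_imp (hd : 0 ≤ d)
    (hb : ∀ j m l w, IsSmoothAtom K d (j + l) w (b j m l w))
    (hμ : ∀ j m l w, μ j m l w ≠ 0 → ∀ i, |(w i : ℝ) / 2 ^ l - m i| ≤ D) {j : ℕ} {m : Fin n → ℤ}
    {L : ℕ} {x : E n} (h : partialSum (μ j m) (b j m) L x ≠ 0) :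
    m ∈ intPoints (fun i => (2 : ℝ) ^ j * x i) (D + d) := by
  obtain ⟨l, -, hl⟩ := Finset.exists_ne_zero_of_sum_ne_zero h
  obtain ⟨w, hw⟩ : ∃ w, μ j m l w * b j m l w x ≠ 0 := by
    by_contra! h0
    exact hl (by simp [h0])
  exact mem_intPoints_of_near hd ((hb j m l w).mem_intPoints (right_ne_zero_of_mul hw))
    (hμ j m l w (left_ne_zero_of_mul hw))

/-- Summing over $k<J$ is summing over the triangle $j+l<J$. The identity is exact at each point
because every sum over indices reduces there to a finite one. -/
theorem partialSum_regrouped (hd : 0 ≤ d)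
    (hb : ∀ j m l w, IsSmoothAtom K d (j + l) w (b j m l w))
    (hμ : ∀ j m l w, μ j m l w ≠ 0 → ∀ i, |(w i : ℝ) / 2 ^ l - m i| ≤ D)
    {ν : ℕ → (Fin n → ℤ) → ℂ} {B : ℕ → (Fin n → ℤ) → E n → ℂ}
    (hB : ∀ k w, IsSmoothAtom K d k w (B k w))
    (hνB : ∀ k w x, ν k w * B k w x = ∑ i ∈ Finset.range (k + 1),
      ∑ m ∈ intPoints (fun t => (w t : ℝ) / 2 ^ i) D,
        c (k - i) m * μ (k - i) m i w * b (k - i) m i w x) (J : ℕ) (x : E n) :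
    partialSum ν B J x = ∑ j ∈ Finset.range J, ∑' m, c j m * partialSum (μ j m) (b j m) (J - j) x := by
  set M : ℕ → Finset (Fin n → ℤ) := fun j => intPoints (fun i => (2 : ℝ) ^ j * x i) (D + d)
  set W : ℕ → Finset (Fin n → ℤ) := fun k => intPoints (fun i => (2 : ℝ) ^ k * x i) d
  set F : ℕ → ℕ → ℂ := fun j l => ∑ m ∈ M j, c j m * ∑' w, μ j m l w * b j m l w x
  have hl (k : ℕ) : ∑' w, ν k w * B k w x = ∑ j ∈ Finset.range (k + 1), F j (k - j) := by
    rw [tsum_eq_sum_intPoints fun w x hx => (hB k w).mem_intPoints hx,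
      ← Finset.sum_flip fun j => F j (k - j)]
    simp_rw [hνB]
    rw [Finset.sum_comm]
    refine Finset.sum_congr rfl fun i hi => ?_
    have hik : i ≤ k := Nat.lt_succ_iff.1 (Finset.mem_range.1 hi)
    have hk : k - i + i = k := Nat.sub_add_cancel hik
    -- The range of `m` depends on `w`. It is replaced by one depending only on `x`, so that the
    -- sums over `m` and `w` can be interchanged.
    have h1 (w) : ∑ m ∈ intPoints (fun t => (w t : ℝ) / 2 ^ i) D,
        c (k - i) m * μ (k - i) m i w * b (k - i) m i w x =
        ∑ m ∈ M (k - i), c (k - i) m * μ (k - i) m i w * b (k - i) m i w x := by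
      trans ∑' m, c (k - i) m * μ (k - i) m i w * b (k - i) m i w x
      · refine (tsum_eq_sum fun m hm => by_contra fun h0 => hm (mem_intPoints.2 ?_)).symm
        exact hμ (k - i) m i w (right_ne_zero_of_mul (left_ne_zero_of_mul h0))
      · refine tsum_eq_sum fun m hm => by_contra fun h0 => hm (mem_intPoints_of_near hd
          (l := i) ((hb (k - i) m i w).mem_intPoints (right_ne_zero_of_mul h0)) ?_)
        exact hμ (k - i) m i w (right_ne_zero_of_mul (left_ne_zero_of_mul h0))
    simp_rw [h1]
    rw [Finset.sum_comm]
    simp only [F, Nat.sub_sub_self hik]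
    refine Finset.sum_congr rfl fun m _ => ?_
    rw [tsum_eq_sum_intPoints (j := k) (D := d) (fun w x hx => by
      have := (hb (k - i) m i w).mem_intPoints hx
      rwa [hk] at this), Finset.mul_sum]
    exact Finset.sum_congr rfl fun w _ => by ring
  calc partialSum ν B J x = ∑ k ∈ Finset.range J, ∑ j ∈ Finset.range (k + 1), F j (k - j) :=
        Finset.sum_congr rfl fun k _ => hl k
    _ = ∑ j ∈ Finset.range J, ∑ l ∈ Finset.range (J - j), F j l := Finset.sum_range_diag_flip J F
    _ = _ := by
        refine Finset.sum_congr rfl fun j _ => ?_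
        rw [tsum_eq_sum (s := M j) fun m hm => by
          rw [not_imp_comm.1 (partialSum_ne_zero_imp hd hb hμ) hm, mul_zero]]
        simp only [F, partialSum, Finset.mul_sum]
        rw [Finset.sum_comm]

theorem exists_regrouped_atom (hb : ∀ j m l w, IsSmoothAtom K d (j + l) w (b j m l w))
    (c : ℕ → (Fin n → ℤ) → ℂ) (μ : ℕ → (Fin n → ℤ) → ℕ → (Fin n → ℤ) → ℂ) (D : ℝ) (k : ℕ)
    (w : Fin n → ℤ) : ∃ B, IsSmoothAtom K d k w B ∧
      ∀ x, (regroupedCoeff D c μ k w : ℂ) * B x = ∑ i ∈ Finset.range (k + 1),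
        ∑ m ∈ intPoints (fun t => (w t : ℝ) / 2 ^ i) D,
          c (k - i) m * μ (k - i) m i w * b (k - i) m i w x := by
  obtain ⟨B, hB, h⟩ := exists_isSmoothAtom_sum_eq (K := K) (d := d) (j := k) (m := w)
    ((Finset.range (k + 1)).sigma fun i => intPoints (fun t => (w t : ℝ) / 2 ^ i) D)
    (fun t => c (k - t.1) t.2 * μ (k - t.1) t.2 t.1 w) (fun t => b (k - t.1) t.2 t.1 w) (by
      intro t ht
      have h1 := Finset.mem_range.1 (Finset.mem_sigma.1 ht).1
      have h2 : k - t.1 + t.1 = k := Nat.sub_add_cancel (Nat.lt_succ_iff.1 h1)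
      have := hb (k - t.1) t.2 t.1 w
      rwa [h2] at this)
  refine ⟨B, hB, fun x => ?_⟩
  rw [Finset.sum_sigma' (Finset.range (k + 1)), h x, regroupedCoeff, Finset.sum_sigma']

theorem ellENorm_le_seqENorm (hq : 0 < q) (c : ℕ → (Fin n → ℤ) → ℂ) (j : ℕ) :
    ellENorm p (fun m => ‖c j m‖ₑ) ≤ 2 ^ (-((j : ℝ) * (s - n / p.toReal))) * seqENorm s p q c := by
  refine le_trans (le_of_eq ?_) (mul_le_mul_right (le_ellENorm hq (fun j : ℕ =>
    (2 : ℝ≥0∞) ^ ((j : ℝ) * (s - n / p.toReal)) * ellENorm p fun m => ‖c j m‖ₑ) j) _)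
  rw [← mul_assoc, ← two_rpow_add]
  simp

/-- Here `h j m L` stands for the tail of a decomposition beyond `L`. Level `j` contributes
$2^{-js}2^{-(J-j)\tau}$, which is largest at $j=J-1$; hence the total size $2^{-Js}$. -/
theorem eLpNorm_regrouped_sub_le (hp : 0 < p) (hq : 0 < q) {T : ℝ≥0∞}
    {h : ℕ → (Fin n → ℤ) → ℕ → E n → ℂ} (hD : 0 ≤ D)
    (hh : ∀ j m L x, h j m L x ≠ 0 → m ∈ intPoints (fun i => (2 : ℝ) ^ j * x i) D)
    (hm : ∀ j m L, AEStronglyMeasurable (h j m L) volume)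
    (hT : ∀ j m L, eLpNorm (h j m L) p volume ≤
      T * 2 ^ (-((j : ℝ) * (n / p.toReal))) * 2 ^ (-((L : ℝ) * τ))) (c : ℕ → (Fin n → ℤ) → ℂ)
    (J : ℕ) :
    eLpNorm (fun x => ∑ j ∈ Finset.range J, ∑' m, c j m * h j m (J - j) x) p volume ≤
      geomConst 1 ((τ - s) / 2) * geomConst p ((τ - s) / 2) *
        (cardBound n D * T * seqENorm s p q c * 2 ^ (s - τ) * 2 ^ (-s * J)) := by
  -- In the reversed index $i=J-1-j$ the terms decay like $2^{-(\tau-s)i}$. Since $J-j=i+1$, a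
  -- factor $2^{s-\tau}$ splits off.
  have hrefl (x : E n) := Finset.sum_range_reflect (fun j => ∑' m, c j m * h j m (J - j) x) J
  simp_rw [← hrefl]
  refine eLpNorm_sum_le_of_geometric
    (g := fun i x => ∑' m, c (J - 1 - i) m * h (J - 1 - i) m (J - (J - 1 - i)) x) hp
    (fun i _ => aestronglyMeasurable_tsum_mul (fun m => hm _ m _) _) fun i hi => ?_
  set j := J - 1 - i with hj
  have hjJ : (j : ℝ) = J - 1 - i := by
    rw [hj, Nat.sub_sub, Nat.cast_sub (by omega)]
    push_cast
    ring
  have hL : ((J - j : ℕ) : ℝ) = i + 1 := by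
    rw [Nat.cast_sub (by omega), hjJ]
    ring
  refine (eLpNorm_tsum_mul_le hp hD (fun m x hx => hh j m _ x hx) (fun m => hm j m _)
    fun m => hT j m _).trans ?_
  refine (mul_le_mul_right (ellENorm_le_seqENorm (s := s) hq c j) _).trans (le_of_eq ?_)
  calc _ = cardBound n D * T * seqENorm s p q c * (2 ^ (-((j : ℝ) * (n / p.toReal))) *
        2 ^ (-(((J - j : ℕ) : ℝ) * τ)) * 2 ^ (-((j : ℝ) * (s - n / p.toReal)))) := by ring
    _ = cardBound n D * T * seqENorm s p q c * (2 ^ (-(τ - s) * i) * 2 ^ (s - τ) *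
        2 ^ (-s * J)) := by
      rw [← two_rpow_add, ← two_rpow_add, ← two_rpow_add, ← two_rpow_add, hL, hjJ]
      ring_nf
    _ = _ := by ring

end Regrouping

/-! ### The regrouping principle -/

section Core

variable {n K : ℕ} {s τ d d' D : ℝ} {A p q : ℝ≥0∞}
  {Atom : ℕ → (Fin n → ℤ) → (E n → ℂ) → Prop}

theorem tendsto_two_rpow_neg_mul (hs : 0 < s) :
    Tendsto (fun J : ℕ => (2 : ℝ≥0∞) ^ (-s * J)) atTop (𝓝 0) := by
  have h (J : ℕ) : (2 : ℝ≥0∞) ^ (-s * J) = ((2 : ℝ≥0∞) ^ (-s)) ^ J := by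
    rw [ENNReal.rpow_mul, ENNReal.rpow_natCast]
  simp_rw [h]
  exact ENNReal.tendsto_pow_atTop_nhds_zero_of_lt_one
    (ENNReal.rpow_lt_one_of_one_lt_of_neg (by norm_num) (by linarith))

/-- If functions in the class `Atom` decompose into smooth atoms with decay rate `τ > s`, then
representations by functions in `Atom` can be turned into representations by smooth atoms. -/
theorem refines_of_decomposes (hp : 0 < p) (hq : 0 < q) (hs : 0 < s) (hsτ : s < τ) (hd' : 0 ≤ d')
    (hD : 0 ≤ D) (hA : A ≠ ∞)
    (hAtom : ∀ j m a, Atom j m a → AEStronglyMeasurable a volume ∧ (∀ x ∉ cube d j m, a x = 0) ∧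
      Decomposes K d' τ D A p j m a) :
    Refines Atom (IsSmoothAtom K d') s p q := by
  refine ⟨(regroupConst n s τ D A p q).toNNReal, fun f hf c a ⟨ha, hc, hconv⟩ => ?_⟩
  rw [ENNReal.coe_toNNReal (regroupConst_ne_top hp hq hsτ hA)]
  have ham (j m) : AEStronglyMeasurable (a j m) volume := (hAtom j m _ (ha j m)).1
  have ha0 (j m) := (hAtom j m _ (ha j m)).2.1
  have hdec (j m) := (hAtom j m _ (ha j m)).2.2
  unfold Decomposes at hdec
  choose μ b hb hnear hμ hlim using hdec
  choose B hB hνB using exists_regrouped_atom hb c μ D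
  have hle := seqENorm_regroupedCoeff_le (s := s) hp hq hD c hμ
  refine ⟨_, B, ⟨hB, hle.trans_lt (ENNReal.mul_lt_top (regroupConst_ne_top hp hq hsτ hA).lt_top hc),
    ?_⟩, hle⟩
  set ν : ℕ → (Fin n → ℤ) → ℂ := fun k w => (regroupedCoeff D c μ k w : ℂ)
  set h : ℕ → (Fin n → ℤ) → ℕ → E n → ℂ := fun j m L x => a j m x - partialSum (μ j m) (b j m) L x
  have hbm (j m l w) : AEStronglyMeasurable (b j m l w) volume :=
    (hb j m l w).continuous.aestronglyMeasurable
  have hhm (j m L) : AEStronglyMeasurable (h j m L) volume :=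
    (ham j m).sub (aestronglyMeasurable_partialSum (hbm j m) L)
  have hmono {y : Fin n → ℝ} {m : Fin n → ℤ} {r r' : ℝ} (hr : r ≤ r') (hm : m ∈ intPoints y r) :
      m ∈ intPoints y r' := mem_intPoints.2 fun i => (mem_intPoints.1 hm i).trans hr
  -- One radius serves both the atoms and the partial sums of their decompositions, hence also the
  -- tails.
  have haM {j m x} (hx : a j m x ≠ 0) :
      m ∈ intPoints (fun i => (2 : ℝ) ^ j * x i) (max d (D + d')) :=
    hmono (le_max_left _ _) (mem_cube_iff.1 (by_contra fun hx' => hx (ha0 j m x hx')))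
  have hPM {j m L x} (hx : partialSum (μ j m) (b j m) L x ≠ 0) :
      m ∈ intPoints (fun i => (2 : ℝ) ^ j * x i) (max d (D + d')) :=
    hmono (le_max_right _ _) (partialSum_ne_zero_imp hd' hb hnear hx)
  have hdiff (J : ℕ) (x : E n) : partialSum c a J x - partialSum ν B J x =
      ∑ j ∈ Finset.range J, ∑' m, c j m * h j m (J - j) x := by
    rw [partialSum_regrouped hd' hb hnear hB hνB, partialSum, ← Finset.sum_sub_distrib]
    refine Finset.sum_congr rfl fun j _ => ?_
    have hfin1 : (Function.support fun m => c j m * a j m x).Finite :=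
      (intPoints (fun i => (2 : ℝ) ^ j * x i) (max d (D + d'))).finite_toSet.subset
        fun m hm => haM (right_ne_zero_of_mul hm)
    have hfin2 : (Function.support fun m => c j m * partialSum (μ j m) (b j m) (J - j) x).Finite :=
      (intPoints (fun i => (2 : ℝ) ^ j * x i) (max d (D + d'))).finite_toSet.subset
        fun m hm => hPM (right_ne_zero_of_mul hm)
    rw [← (summable_of_hasFiniteSupport hfin1).tsum_sub (summable_of_hasFiniteSupport hfin2)]
    exact tsum_congr fun m => by simp only [h]; ring
  have hest (J : ℕ) := eLpNorm_regrouped_sub_le (s := s) (τ := τ) (D := max d (D + d')) hp hq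
    (T := tailConst n d' τ A p) (h := h) (le_max_of_le_right (by positivity))
    (fun j m L x hx => by
      by_cases hax : a j m x = 0
      · refine hPM (L := L) fun h0 => hx ?_
        simp only [h, hax, h0, sub_zero]
      · exact haM hax) hhm
    (fun j m L => eLpNorm_tail_le hp hd' (ham j m) (hb j m) (hμ j m) (hlim j m) L) c J
  simp_rw [← hdiff] at hest
  have hzero : Tendsto (fun J => eLpNorm (fun x => partialSum c a J x - partialSum ν B J x) p volume)
      atTop (𝓝 0) := by
    refine tendsto_of_tendsto_of_tendsto_of_le_of_le tendsto_const_nhds ?_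
      (fun _ => zero_le) hest
    have hδ : 0 < (τ - s) / 2 := by linarith
    have h1 : geomConst 1 ((τ - s) / 2) * geomConst p ((τ - s) / 2) ≠ ∞ :=
      ENNReal.mul_ne_top (geomConst_ne_top one_pos hδ) (geomConst_ne_top hp hδ)
    have h2 : cardBound n (max d (D + d')) * tailConst n d' τ A p * seqENorm s p q c *
        2 ^ (s - τ) ≠ ∞ :=
      ENNReal.mul_ne_top (ENNReal.mul_ne_top (ENNReal.mul_ne_top cardBound_ne_top
        (tailConst_ne_top hp (hs.trans hsτ) hA)) hc.ne) (two_rpow_ne_top _)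
    simpa using ENNReal.Tendsto.const_mul (ENNReal.Tendsto.const_mul
      (tendsto_two_rpow_neg_mul hs) (Or.inr h2)) (Or.inr h1)
  have hadd : Tendsto (fun J => ENNReal.LpAddConst p *
      (eLpNorm (fun x => f x - partialSum c a J x) p volume +
        eLpNorm (fun x => partialSum c a J x - partialSum ν B J x) p volume)) atTop (𝓝 0) := by
    simpa using ENNReal.Tendsto.const_mul (hconv.add hzero)
      (Or.inr (ENNReal.LpAddConst_lt_top p).ne)
  refine tendsto_of_tendsto_of_tendsto_of_le_of_le tendsto_const_nhds hadd (fun _ => zero_le)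
    fun J => ?_
  have hm1 : AEStronglyMeasurable (fun x => f x - partialSum c a J x) volume :=
    hf.1.sub (aestronglyMeasurable_partialSum ham J)
  have hm2 : AEStronglyMeasurable (fun x => partialSum c a J x - partialSum ν B J x) volume :=
    (aestronglyMeasurable_partialSum ham J).sub
      (aestronglyMeasurable_partialSum (fun k w => (hB k w).continuous.aestronglyMeasurable) J)
  refine le_trans (le_of_eq ?_) (eLpNorm_add_le' hm1 hm2 p)
  congr 1
  ext x
  rw [Pi.add_apply]
  ring

end Core

/-! ### Derivative bounds, atoms and cutoffs -/

section DerivBounds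

variable {n K : ℕ} {f g : E n → ℂ} {A B r : ℝ}

/-- `f` is of class `C^K`, and its derivatives of order `k ≤ K` are bounded by `A r^k`. -/
def HasDerivBounds (K : ℕ) (f : E n → ℂ) (A r : ℝ) : Prop :=
  ContDiff ℝ K f ∧ ∀ k ≤ K, ∀ x, ‖iteratedFDeriv ℝ k f x‖ ≤ A * r ^ k

theorem HasDerivBounds.mono {A' r' : ℝ} (h : HasDerivBounds K f A r) (hA : 0 ≤ A') (hr : 0 ≤ r)
    (hAA : A ≤ A') (hrr : r ≤ r') : HasDerivBounds K f A' r' :=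
  ⟨h.1, fun k hk x => (h.2 k hk x).trans (by gcongr)⟩

theorem HasDerivBounds.norm_le (h : HasDerivBounds K f A r) (x : E n) : ‖f x‖ ≤ A := by
  simpa using h.2 0 (Nat.zero_le K) x

theorem HasDerivBounds.nonneg (h : HasDerivBounds K f A r) : 0 ≤ A :=
  (norm_nonneg _).trans (h.norm_le 0)

theorem HasDerivBounds.mul (hf : HasDerivBounds K f A r) (hg : HasDerivBounds K g B r)
    (hr : 0 ≤ r) : HasDerivBounds K (fun x => f x * g x) (2 ^ K * A * B) r := by
  have hA := hf.nonneg
  have hB := hg.nonneg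
  refine ⟨hf.1.mul hg.1, fun k hk x => ?_⟩
  calc ‖iteratedFDeriv ℝ k (fun y => f y * g y) x‖
      ≤ ∑ i ∈ Finset.range (k + 1),
        (k.choose i : ℝ) * ‖iteratedFDeriv ℝ i f x‖ * ‖iteratedFDeriv ℝ (k - i) g x‖ :=
        norm_iteratedFDeriv_mul_le hf.1 hg.1 x (by exact_mod_cast hk)
    _ ≤ ∑ i ∈ Finset.range (k + 1), (k.choose i : ℝ) * (A * B * r ^ k) := by
        refine Finset.sum_le_sum fun i hi => ?_
        have hik : i ≤ k := Nat.lt_succ_iff.1 (Finset.mem_range.1 hi)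
        rw [mul_assoc]
        refine mul_le_mul_of_nonneg_left ?_ (Nat.cast_nonneg _)
        calc _ ≤ A * r ^ i * (B * r ^ (k - i)) := by
              gcongr
              · exact hf.2 i (hik.trans hk) x
              · exact hg.2 _ ((Nat.sub_le _ _).trans hk) x
          _ = A * B * (r ^ i * r ^ (k - i)) := by ring
          _ = A * B * r ^ k := by rw [← pow_add, Nat.add_sub_cancel' hik]
    _ = 2 ^ k * (A * B * r ^ k) := by
        rw [← Finset.sum_mul]
        congr 1
        exact_mod_cast Nat.sum_range_choose k
    _ ≤ 2 ^ K * (A * B * r ^ k) := by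
        gcongr
        norm_num
    _ = 2 ^ K * A * B * r ^ k := by ring

theorem HasDerivBounds.const_mul (h : HasDerivBounds K f A r) (c : ℂ) :
    HasDerivBounds K (fun x => c * f x) (‖c‖ * A) r := by
  refine ⟨h.1.const_smul c, fun k hk x => ?_⟩
  simp_rw [← smul_eq_mul (a := c)]
  rw [iteratedFDeriv_const_smul_apply' (h.1.of_le (by exact_mod_cast hk)).contDiffAt, norm_smul,
    mul_assoc]
  gcongr
  exact h.2 k hk x

theorem HasDerivBounds.sub (hf : HasDerivBounds K f A r) (hg : HasDerivBounds K g B r) :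
    HasDerivBounds K (fun x => f x - g x) (A + B) r := by
  refine ⟨hf.1.sub hg.1, fun k hk x => ?_⟩
  have hk' : (k : WithTop ℕ∞) ≤ K := by exact_mod_cast hk
  have := iteratedFDeriv_sub_apply (𝕜 := ℝ) (x := x) (hf.1.of_le hk').contDiffAt
    (hg.1.of_le hk').contDiffAt
  change ‖iteratedFDeriv ℝ k (f - g) x‖ ≤ _
  rw [this, add_mul]
  exact (norm_sub_le _ _).trans (add_le_add (hf.2 k hk x) (hg.2 k hk x))

theorem HasDerivBounds.comp_smul (h : HasDerivBounds K f A r) {c : ℝ} (hc : 0 ≤ c) :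
    HasDerivBounds K (fun x => f (c • x)) A (c * r) := by
  refine ⟨h.1.comp (contDiff_const_smul c), fun k hk x => ?_⟩
  rw [iteratedFDeriv_comp_const_smul c (h.1.of_le (by exact_mod_cast hk)), norm_smul, norm_pow,
    Real.norm_of_nonneg hc, mul_pow]
  calc c ^ k * ‖iteratedFDeriv ℝ k f (c • x)‖ ≤ c ^ k * (A * r ^ k) := by
        gcongr
        exact h.2 k hk _
    _ = A * (c ^ k * r ^ k) := by ring

theorem HasDerivBounds.comp_sub (h : HasDerivBounds K f A r) (y : E n) :
    HasDerivBounds K (fun x => f (x - y)) A r :=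
  ⟨h.1.comp (contDiff_id.sub contDiff_const), fun k hk x => by
    rw [iteratedFDeriv_comp_sub]
    exact h.2 k hk _⟩

theorem exists_hasDerivBounds (K : ℕ) (hf : ContDiff ℝ K f) (hc : HasCompactSupport f) :
    ∃ A, 0 < A ∧ HasDerivBounds K f A 1 := by
  have h (k : ℕ) : ∃ C, k ≤ K → ∀ x, ‖iteratedFDeriv ℝ k f x‖ ≤ C := by
    by_cases hk : k ≤ K
    · obtain ⟨C, hC⟩ := (hf.continuous_iteratedFDeriv (m := k)
        (by exact_mod_cast hk)).bounded_above_of_compact_support (hc.iteratedFDeriv k)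
      exact ⟨C, fun _ => hC⟩
    · exact ⟨0, fun h => absurd h hk⟩
  choose C hC using h
  refine ⟨∑ k ∈ Finset.range (K + 1), |C k| + 1, by positivity, hf, fun k hk x => ?_⟩
  rw [one_pow, mul_one]
  have h1 : |C k| ≤ ∑ k ∈ Finset.range (K + 1), |C k| :=
    Finset.single_le_sum (f := fun k => |C k|) (fun _ _ => abs_nonneg _)
      (Finset.mem_range.2 (Nat.lt_succ_of_le hk))
  linarith [hC k hk x, le_abs_self (C k)]

/-- Atoms control only partial derivatives, while the Leibniz rule and scaling are applied to
operator norms; expanding in the standard basis costs a factor $n^k$. -/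
theorem norm_multilinear_le_of_basis {k : ℕ}
    (T : ContinuousMultilinearMap ℝ (fun _ : Fin k => E n) ℂ) {M : ℝ} (hM : 0 ≤ M)
    (h : ∀ v : Fin k → Fin n, ‖T fun l => EuclideanSpace.single (v l) (1 : ℝ)‖ ≤ M) :
    ‖T‖ ≤ (n : ℝ) ^ k * M := by
  refine ContinuousMultilinearMap.opNorm_le_bound (by positivity) fun y => ?_
  have hy : y = fun l => ∑ i, y l i • EuclideanSpace.single i (1 : ℝ) := by
    ext l i
    simp [Finset.sum_apply, Pi.single_apply]
  have h1 : T y = ∑ v : Fin k → Fin n,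
      T.toMultilinearMap fun l => y l (v l) • EuclideanSpace.single (v l) (1 : ℝ) := by
    conv_lhs => rw [hy]
    exact T.toMultilinearMap.map_sum fun l i => y l i • EuclideanSpace.single i (1 : ℝ)
  rw [h1]
  calc _ ≤ ∑ _v : Fin k → Fin n, (∏ l, ‖y l‖) * M := by
        refine norm_sum_le_of_le _ fun v _ => ?_
        rw [MultilinearMap.map_smul_univ, norm_smul, norm_prod]
        refine mul_le_mul (Finset.prod_le_prod (fun _ _ => norm_nonneg _) fun l _ =>
          PiLp.norm_apply_le _ _) (h v) (norm_nonneg _) (by positivity)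
    _ = (n : ℝ) ^ k * M * ∏ l, ‖y l‖ := by
        rw [Finset.sum_const, Finset.card_univ, Fintype.card_fun, Fintype.card_fin,
          Fintype.card_fin, nsmul_eq_mul]
        push_cast
        ring

variable {d : ℝ} {j : ℕ} {m : Fin n → ℤ} {a : E n → ℂ}

theorem IsSmoothAtom.hasDerivBounds (h : IsSmoothAtom K d j m a) :
    HasDerivBounds K a ((n + 1) ^ K) (2 ^ j) := by
  refine ⟨h.1, fun k hk x => ?_⟩
  refine (norm_multilinear_le_of_basis _ (by positivity) fun v => h.2.2 k hk v x).trans ?_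
  rw [← pow_mul, mul_comm j]
  gcongr
  -- The base is raised to $n+1\ge 1$ because $n^k\le n^K$ fails for $n=k=0<K$.
  calc (n : ℝ) ^ k ≤ (n + 1) ^ k := by gcongr; linarith
    _ ≤ (n + 1) ^ K := by gcongr; linarith [(n.cast_nonneg : (0 : ℝ) ≤ n)]

theorem HasDerivBounds.isSmoothAtom (h : HasDerivBounds K a A (2 ^ j)) (hA : 0 < A)
    (h0 : ∀ x ∉ cube d j m, a x = 0) : IsSmoothAtom K d j m fun x => (A : ℂ)⁻¹ * a x := by
  have h1 := h.const_mul (A : ℂ)⁻¹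
  rw [norm_inv, Complex.norm_real, Real.norm_of_nonneg hA.le, inv_mul_cancel₀ hA.ne'] at h1
  refine ⟨h1.1, tsupport_subset_cube fun x hx => by rw [h0 x hx, mul_zero], fun k hk v x => ?_⟩
  refine (ContinuousMultilinearMap.le_opNorm _ _).trans ?_
  rw [Finset.prod_eq_one fun l _ => by simp, mul_one]
  refine (h1.2 k hk x).trans_eq ?_
  rw [one_mul, ← pow_mul, mul_comm]

theorem exists_cutoff (n K : ℕ) (d : ℝ) : ∃ (ψ : E n → ℂ) (A R : ℝ), 0 < A ∧ 0 ≤ R ∧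
    HasDerivBounds K ψ A 1 ∧ (∀ x ∈ cube d 0 (0 : Fin n → ℤ), ψ x = 1) ∧ (∀ x, ‖ψ x‖ ≤ 1) ∧
    ∀ x, ψ x ≠ 0 → ∀ i, |x i| ≤ R := by
  obtain ⟨r, hr⟩ := (isCompact_cube d 0 (0 : Fin n → ℤ)).isBounded.subset_closedBall 0
  let φ : ContDiffBump (0 : E n) := ⟨max r 1, max r 1 + 1, by positivity, by linarith⟩
  have hφ : ContDiff ℝ K fun x => (φ x : ℂ) := Complex.ofRealCLM.contDiff.comp φ.contDiff
  have hs : HasCompactSupport fun x => (φ x : ℂ) :=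
    φ.hasCompactSupport.comp_left (g := fun t : ℝ => (t : ℂ)) Complex.ofReal_zero
  obtain ⟨A, hA, hbd⟩ := exists_hasDerivBounds K hφ hs
  refine ⟨fun x => (φ x : ℂ), A, max r 1 + 1, hA, by positivity, hbd, fun x hx => ?_, fun x => ?_,
    fun x hx i => ?_⟩
  · beta_reduce
    rw [φ.one_of_mem_closedBall (Metric.closedBall_subset_closedBall (le_max_left _ _) (hr hx)),
      Complex.ofReal_one]
  · rw [Complex.norm_real, Real.norm_of_nonneg φ.nonneg]
    exact φ.le_one
  · have h1 : x ∈ Function.support φ := fun h0 => hx (by simp only [h0, Complex.ofReal_zero])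
    rw [φ.support_eq, mem_ball_zero_iff] at h1
    exact (PiLp.norm_apply_le x i).trans h1.le

end DerivBounds

/-! ### Non-smooth atoms versus smooth atoms -/

section NonsmoothAtoms

variable {n K : ℕ} {d d' σ : ℝ} {p q : ℝ≥0∞} {j : ℕ} {m : Fin n → ℤ} {a : E n → ℂ}

theorem tendsto_eLpNorm_comp_smul {F : ℕ → E n → ℂ} {c : ℝ} (hc : c ≠ 0)
    (h : Tendsto (fun L => eLpNorm (F L) p volume) atTop (𝓝 0)) :
    Tendsto (fun L => eLpNorm (fun x => F L (c • x)) p volume) atTop (𝓝 0) := by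
  have h1 (L : ℕ) : eLpNorm (fun x => F L (c • x)) p volume =
      ENNReal.ofReal |(c ^ Module.finrank ℝ (E n))⁻¹| ^ (1 / p).toReal *
        eLpNorm (F L) p volume := by
    have h2 := (Homeomorph.smulOfNeZero c hc).measurableEmbedding.eLpNorm_map_measure
      (μ := (volume : Measure (E n))) (g := F L) (p := p)
    have h3 : Measure.map (Homeomorph.smulOfNeZero c hc) (volume : Measure (E n)) = _ :=
      Measure.map_addHaar_smul volume hc
    rw [h3, eLpNorm_smul_measure_of_ne_zero (ENNReal.ofReal_pos.2 (by positivity)).ne',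
      smul_eq_mul] at h2
    exact h2.symm
  simp_rw [h1]
  simpa only [mul_zero] using ENNReal.Tendsto.const_mul h
    (Or.inr (ENNReal.rpow_ne_top_of_nonneg ENNReal.toReal_nonneg ENNReal.ofReal_ne_top))

/-- A $b^\sigma_{p,p}$ bound on the coefficients of the rescaled atom gives at each level the decay
with $\tau=\sigma$. The given representation may use atoms far from the cube; a cutoff equal to $1$
on the support of the rescaled atom removes them. -/
theorem exists_decomposes_of_isNonsmoothAtom (n K : ℕ) {d' : ℝ} (d σ : ℝ) (hd' : 0 ≤ d')
    (hp : 0 < p) : ∃ (A : ℝ≥0∞) (D : ℝ), A ≠ ∞ ∧ 0 ≤ D ∧ ∀ (j : ℕ) (m : Fin n → ℤ) (a : E n → ℂ),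
      IsNonsmoothAtom K d' σ p d j m a → AEStronglyMeasurable a volume ∧
        (∀ x ∉ cube d j m, a x = 0) ∧ Decomposes K d' σ D A p j m a := by
  obtain ⟨ψ, A, R, hA, hR, hψ, hψ1, hψle, hψR⟩ := exists_cutoff n K d
  -- The Leibniz bound for the product of the cutoff with an atom; dividing by it turns the product
  -- into an atom again.
  set S : ℝ := 2 ^ K * A * (n + 1) ^ K
  have hS : 0 < S := by positivity
  have hSC : (S : ℂ) ≠ 0 := by exact_mod_cast hS.ne'
  refine ⟨‖(S : ℂ)‖ₑ * 2, R + d', ENNReal.mul_ne_top enorm_ne_top ENNReal.ofNat_ne_top,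
    by positivity, fun j m a ⟨hB, hsupp, hnorm⟩ => ?_⟩
  have ha0 : ∀ x ∉ cube d j m, a x = 0 := fun x hx => eq_zero_of_tsupport_subset hsupp hx
  refine ⟨hB.1.1, ha0, ?_⟩
  -- The infimum need not be attained, so a representation of norm below $2$ is chosen.
  obtain ⟨c, hc⟩ := iInf_lt_iff.1 (lt_of_le_of_lt hnorm (by norm_num : (1 : ℝ≥0∞) < 2))
  obtain ⟨b, hb⟩ := iInf_lt_iff.1 hc
  obtain ⟨⟨hatom, -, hconv⟩, hlt⟩ := iInf_lt_iff.1 hb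
  set y : E n := WithLp.toLp 2 fun i => (m i : ℝ)
  set ψ' : E n → ℂ := fun x => ψ ((2 : ℝ) ^ j • x - y)
  have hψ'b : HasDerivBounds K ψ' A (2 ^ j) := by
    simpa using (hψ.comp_sub y).comp_smul (c := (2 : ℝ) ^ j) (by positivity)
  classical
  set near : ℕ → (Fin n → ℤ) → Prop := fun l w => ∀ i, |(w i : ℝ) / 2 ^ l - m i| ≤ R + d'
  have hprod (l w) (x : E n) (hx : ψ' x * b l w ((2 : ℝ) ^ j • x) ≠ 0) :
      (2 : ℝ) ^ j • x ∈ cube d' l w ∧ near l w := by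
    have hmem : (2 : ℝ) ^ j • x ∈ cube d' l w :=
      by_contra fun h => right_ne_zero_of_mul hx ((hatom l w).eq_zero h)
    refine ⟨hmem, fun i => ?_⟩
    have h1 := hψR _ (left_ne_zero_of_mul hx) i
    have h2 := hmem i
    rw [zpow_neg, zpow_natCast, inv_mul_eq_div, ← div_eq_mul_inv] at h2
    have h3 : d' / 2 ^ l ≤ d' := div_le_self hd' (one_le_pow₀ one_le_two)
    have h4 : ((2 : ℝ) ^ j • x - y) i = ((2 : ℝ) ^ j • x) i - m i := rfl
    rw [h4] at h1
    calc |(w i : ℝ) / 2 ^ l - m i| ≤ |(w i : ℝ) / 2 ^ l - ((2 : ℝ) ^ j • x) i| +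
          |((2 : ℝ) ^ j • x) i - m i| := abs_sub_le _ _ _
      _ ≤ R + d' := by rw [abs_sub_comm]; linarith
  refine ⟨fun l w => if near l w then S * c l w else 0,
    fun l w x => (S : ℂ)⁻¹ * (ψ' x * b l w ((2 : ℝ) ^ j • x)), fun l w => ?_, fun l w h => ?_,
    fun l => ?_, ?_⟩
  · have h1 : HasDerivBounds K ψ' A (2 ^ (j + l)) :=
      hψ'b.mono hA.le (by positivity) le_rfl (pow_le_pow_right₀ one_le_two (Nat.le_add_right _ _))
    have h2 : HasDerivBounds K (fun x => b l w ((2 : ℝ) ^ j • x)) ((n + 1) ^ K) (2 ^ (j + l)) := by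
      rw [pow_add]
      exact (hatom l w).hasDerivBounds.comp_smul (by positivity)
    refine (h1.mul h2 (by positivity)).isSmoothAtom hS fun x hx => by_contra fun h => hx ?_
    have := (hprod l w x h).1
    rw [mem_cube_iff] at this ⊢
    convert this using 3 with i
    simp only [PiLp.smul_apply, smul_eq_mul, pow_add]
    ring
  · exact by_contra fun h' => h (if_neg h')
  · calc ellENorm p (fun w => ‖if near l w then S * c l w else 0‖ₑ)
        ≤ ‖(S : ℂ)‖ₑ * ellENorm p (fun w => ‖c l w‖ₑ) := by
          rw [← ellENorm_const_mul hp]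
          refine ellENorm_mono fun w => ?_
          split_ifs
          · rw [enorm_mul]
          · simp
      _ ≤ ‖(S : ℂ)‖ₑ * (2 ^ (-((l : ℝ) * (σ - n / p.toReal))) * 2) := by
          gcongr
          refine (ellENorm_le_seqENorm (s := σ) hp c l).trans ?_
          gcongr
      _ = _ := by ring
  · refine tendsto_of_tendsto_of_tendsto_of_le_of_le tendsto_const_nhds
      (tendsto_eLpNorm_comp_smul (c := (2 : ℝ) ^ j) (by positivity) hconv) (fun _ => zero_le)
      fun L => eLpNorm_mono fun x => ?_
    have hx : (2 : ℝ) ^ (-(j : ℤ)) • (2 : ℝ) ^ j • x = x := by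
      rw [smul_smul, zpow_neg, zpow_natCast, inv_mul_cancel₀ (by positivity), one_smul]
    simp only [hx]
    -- Since the cutoff fixes `a`, the new error is the cutoff times the old one, and the cutoff is
    -- bounded by $1$.
    have h1 : a x = ψ' x * a x := by
      by_cases hxm : x ∈ cube d j m
      · have : ψ' x = 1 := by
          refine hψ1 _ ?_
          rw [mem_cube_iff, mem_intPoints] at hxm ⊢
          intro i
          have := hxm i
          simpa [y] using this
        rw [this, one_mul]
      · rw [ha0 x hxm, mul_zero]
    have h2 : partialSum (fun l w => if near l w then S * c l w else 0)
        (fun l w x => (S : ℂ)⁻¹ * (ψ' x * b l w ((2 : ℝ) ^ j • x))) L x =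
        ψ' x * partialSum c b L ((2 : ℝ) ^ j • x) := by
      rw [partialSum, partialSum, Finset.mul_sum]
      refine Finset.sum_congr rfl fun l _ => ?_
      rw [← tsum_mul_left]
      refine tsum_congr fun w => ?_
      split_ifs with h
      · field_simp
      · rw [zero_mul]
        have : ψ' x * b l w ((2 : ℝ) ^ j • x) = 0 :=
          by_contra fun h' => h (hprod l w x h').2
        rw [mul_left_comm, this, mul_zero]
    rw [h2, h1, ← mul_sub, norm_mul]
    have h3 : a x - partialSum c b L ((2 : ℝ) ^ j • x) = ψ' x * a x -
      partialSum c b L ((2 : ℝ) ^ j • x) := by rw [← h1]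
    rw [← h3]
    exact mul_le_of_le_one_left (norm_nonneg _) (hψle _)

theorem IsSmoothAtom.mono (h : IsSmoothAtom K d j m a) (hd : d ≤ d') : IsSmoothAtom K d' j m a :=
  ⟨h.1, h.2.1.trans fun x hx i => (hx i).trans (by gcongr), h.2.2⟩

theorem IsSmoothAtom.comp_smul (h : IsSmoothAtom K d j m a) :
    IsSmoothAtom K d 0 m fun x => a ((2 : ℝ) ^ (-(j : ℤ)) • x) := by
  refine ⟨h.1.comp (contDiff_const_smul _), tsupport_subset_cube fun x hx => h.eq_zero fun hx' =>
    hx ?_, fun k hk v x => ?_⟩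
  · rw [mem_cube_iff] at hx' ⊢
    convert hx' using 3 with i
    simp
  · rw [iteratedFDeriv_comp_const_smul _ (h.1.of_le (by exact_mod_cast hk)),
      _root_.smul_apply, norm_smul, zpow_neg, zpow_natCast, norm_pow, norm_inv, norm_pow,
      Real.norm_ofNat, inv_pow, inv_mul_le_iff₀ (by positivity), mul_zero, pow_zero, mul_one,
      ← pow_mul, mul_comm j]
    exact h.2.2 k hk v _

theorem ellENorm_eq_single {ι : Type} (hp : 0 < p) {c : ι → ℝ≥0∞} (i : ι)
    (h : ∀ i' ≠ i, c i' = 0) : ellENorm p c = c i := by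
  refine le_antisymm ?_ (le_ellENorm hp c i)
  refine (ellENorm_indicator_le hp {i} (c i) c (by simp) (by simpa using h)).trans_eq ?_
  simp

theorem IsSmoothAtom.exists_isRepr (h : IsSmoothAtom K d j m a) (hp : 0 < p) (hq : 0 < q) :
    ∃ c b, IsRepr (IsSmoothAtom K d) σ p q a c b ∧
      seqENorm σ p q c = 2 ^ ((j : ℝ) * (σ - n / p.toReal)) := by
  classical
  set c : ℕ → (Fin n → ℤ) → ℂ := fun k w => if k = j ∧ w = m then 1 else 0
  set b : ℕ → (Fin n → ℤ) → E n → ℂ := fun k w => if k = j ∧ w = m then a else fun _ => 0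
  have hc : seqENorm σ p q c = 2 ^ ((j : ℝ) * (σ - n / p.toReal)) := by
    rw [seqENorm, ellENorm_eq_single hq j, ellENorm_eq_single hp m]
    · simp [c]
    · intro w hw
      simp [c, hw]
    · intro k hk
      rw [ellENorm_eq_single hp m] <;> simp [c, hk]
  refine ⟨c, b, ⟨fun k w => ?_, ?_, ?_⟩, hc⟩
  · simp only [b]
    split_ifs with hkw
    · rwa [hkw.1, hkw.2]
    · exact isSmoothAtom_zero K d k w
  · rw [hc]
    exact (two_rpow_ne_top _).lt_top
  · refine tendsto_const_nhds.congr' ?_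
    filter_upwards [eventually_gt_atTop j] with J hJ
    have : (fun x => a x - partialSum c b J x) = fun _ => 0 := by
      ext x
      rw [partialSum, Finset.sum_eq_single j, tsum_eq_single m]
      · simp [b, c]
      · intro w hw
        simp [c, hw]
      · intro k _ hk
        simp [c, hk]
      · exact fun h => absurd (Finset.mem_range.2 hJ) h
    rw [this]
    exact eLpNorm_zero.symm

/-- Dilation moves the atom to level $0$, where the one-term representation has norm $2^0=1$. The
minimum serves both `d`, for the support, and `d'`, for the atoms of the Besov space. -/
theorem IsSmoothAtom.isNonsmoothAtom (h : IsSmoothAtom K (min d d') j m a) (hp : 0 < p) :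
    IsNonsmoothAtom K d' σ p d j m a := by
  have h' := h.mono (min_le_right d d')
  refine ⟨⟨?_, ?_⟩, (h.mono (min_le_left d d')).2.1, ?_⟩
  · refine h.continuous.memLp_of_hasCompactSupport ?_
    exact (isCompact_cube _ _ _).of_isClosed_subset (isClosed_tsupport a) h.2.1
  · obtain ⟨c, b, hr, -⟩ := h'.exists_isRepr (σ := σ) hp hp
    exact ⟨c, b, hr⟩
  · obtain ⟨c, b, hr, hc⟩ := h'.comp_smul.exists_isRepr (σ := σ) hp hp
    refine (reprENorm_le hr).trans_eq ?_
    rw [hc]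
    simp

end NonsmoothAtoms

/-! ### Iterated mollification errors -/

section Mollification

variable {n : ℕ} {G : Type} [NormedAddCommGroup G] [NormedSpace ℝ G]

/-- A fixed smooth bump function supported in the unit ball. -/
noncomputable def unitBump (n : ℕ) : ContDiffBump (0 : E n) :=
  ⟨1 / 2, 1, by norm_num, by norm_num⟩

/-- Convolution with a fixed smooth probability density supported in the unit ball. -/
noncomputable def mollify (F : E n → G) : E n → G :=
  convolution ((unitBump n).normed volume) F (ContinuousLinearMap.lsmul ℝ ℝ) volume

theorem hasCompactSupport_mollify {F : E n → G} (hF : HasCompactSupport F) :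
    HasCompactSupport (mollify F) :=
  HasCompactSupport.convolution _ (unitBump n).hasCompactSupport_normed hF

theorem contDiff_mollify {F : E n → G} (hF : Continuous F) (N : ℕ) :
    ContDiff ℝ N (mollify F) :=
  (unitBump n).hasCompactSupport_normed.contDiff_convolution_left (n := (N : ℕ∞)) _
    (unitBump n).contDiff_normed hF.locallyIntegrable

theorem mollify_support {F : E n → G} {y : E n} {ρ : ℝ}
    (hF : ∀ x, F x ≠ 0 → ∀ i, |x i - y i| ≤ ρ) (x : E n) (hx : mollify F x ≠ 0) (i : Fin n) :
    |x i - y i| ≤ ρ + 1 := by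
  obtain ⟨t, ht, z, hz, rfl⟩ := Set.mem_add.1 (support_convolution_subset _ hx)
  rw [(unitBump n).support_normed_eq, mem_ball_zero_iff] at ht
  have ht' : ‖t‖ < 1 := ht
  have h1 := hF z hz i
  have h2 := PiLp.norm_apply_le t i
  rw [Real.norm_eq_abs] at h2
  calc |(t + z) i - y i| = |(z i - y i) + t i| := by
        rw [PiLp.add_apply]
        ring_nf
    _ ≤ |z i - y i| + |t i| := abs_add_le _ _
    _ ≤ ρ + 1 := by linarith

/-- All derivatives fall on the kernel. The target spaces and the bilinear map are general because
each differentiation changes them in the induction. -/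
theorem norm_iteratedFDeriv_convolution_le {H G' : Type} [NormedAddCommGroup H] [NormedSpace ℝ H]
    [NormedAddCommGroup G'] [NormedSpace ℝ G'] {F : E n → G} (hF : Continuous F) {M : ℝ}
    (hM : ∀ x, ‖F x‖ ≤ M) (i : ℕ) {φ : E n → H} (hφ : ContDiff ℝ i φ) (hc : HasCompactSupport φ)
    (L : H →L[ℝ] G →L[ℝ] G') (x : E n) :
    ‖iteratedFDeriv ℝ i (convolution φ F L volume) x‖ ≤
      ‖L‖ * (∫ t, ‖iteratedFDeriv ℝ i φ t‖) * M := by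
  have hM0 : 0 ≤ M := (norm_nonneg _).trans (hM 0)
  induction i generalizing H G' with
  | zero =>
    simp_rw [norm_iteratedFDeriv_zero]
    rw [← integral_const_mul, ← integral_mul_const, convolution_def]
    have hint : Integrable φ volume := hφ.continuous.integrable_of_hasCompactSupport hc
    refine norm_integral_le_of_norm_le ((hint.norm.const_mul _).mul_const _)
      (ae_of_all _ fun t => ?_)
    refine (L.le_opNorm₂ _ _).trans ?_
    gcongr
    exact hM _
  | succ i ih =>
    have h1 : fderiv ℝ (convolution φ F L volume) =
        convolution (fderiv ℝ φ) F (L.precompL (E n)) volume := by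
      ext1 z
      exact (hc.hasFDerivAt_convolution_left L (hφ.of_le (by exact_mod_cast Nat.le_add_left 1 i))
        hF.locallyIntegrable z).fderiv
    rw [← norm_iteratedFDeriv_fderiv, h1]
    refine (ih (hφ.fderiv_right (by exact_mod_cast le_rfl)) (hc.fderiv ℝ) _).trans ?_
    simp_rw [norm_iteratedFDeriv_fderiv]
    gcongr
    exact ContinuousLinearMap.norm_precompL_le _ _

/-- The error of mollification. -/
noncomputable def mollifyError (F : E n → G) : E n → G := F - mollify F

theorem contDiff_mollifyError {F : E n → G} {K : ℕ} (hF : ContDiff ℝ K F) :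
    ContDiff ℝ K (mollifyError F) :=
  hF.sub (contDiff_mollify hF.continuous K)

theorem hasCompactSupport_mollifyError {F : E n → G} (hF : HasCompactSupport F) :
    HasCompactSupport (mollifyError F) :=
  hF.sub (hasCompactSupport_mollify hF)

theorem contDiff_iterate_mollifyError {F : E n → G} {K : ℕ} (hF : ContDiff ℝ K F) (c : ℕ) :
    ContDiff ℝ K (mollifyError^[c] F) :=
  Function.Iterate.rec (fun F : E n → G => ContDiff ℝ K F) hF (fun _ => contDiff_mollifyError) c

theorem hasCompactSupport_iterate_mollifyError {F : E n → G} (hF : HasCompactSupport F) (c : ℕ) :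
    HasCompactSupport (mollifyError^[c] F) :=
  Function.Iterate.rec (fun F : E n → G => HasCompactSupport F) hF
    (fun _ => hasCompactSupport_mollifyError) c

theorem iterate_mollifyError_support {F : E n → G} {y : E n} {ρ : ℝ}
    (hF : ∀ x, F x ≠ 0 → ∀ i, |x i - y i| ≤ ρ) (c : ℕ) (x : E n)
    (hx : mollifyError^[c] F x ≠ 0) (i : Fin n) : |x i - y i| ≤ ρ + c := by
  induction c generalizing x i with
  | zero => simpa using hF x hx i
  | succ c ih =>
    rw [Function.iterate_succ_apply', mollifyError, Pi.sub_apply] at hx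
    push_cast
    by_cases h0 : mollifyError^[c] F x = 0
    · have := mollify_support ih x (fun h1 => hx (by rw [h0, h1, sub_zero])) i
      linarith
    · linarith [ih x h0 i]

theorem fderiv_mollify {F : E n → G} (hF : ContDiff ℝ 1 F) (hc : HasCompactSupport F) :
    fderiv ℝ (mollify F) = mollify (fderiv ℝ F) := by
  ext1 x
  rw [mollify, (hc.hasFDerivAt_convolution_right (ContinuousLinearMap.lsmul ℝ ℝ)
    ((unitBump n).contDiff_normed (n := 0)).continuous.locallyIntegrable hF x).fderiv, mollify,
    convolution_def, convolution_def]
  refine integral_congr_ae (ae_of_all _ fun t => ?_)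
  ext v
  simp [ContinuousLinearMap.precompR_apply]

variable [CompleteSpace G]

theorem norm_mollify_le {F : E n → G} (hF : Continuous F) {M : ℝ} (hM : ∀ x, ‖F x‖ ≤ M) (x : E n) :
    ‖mollify F x‖ ≤ M := by
  rw [← dist_zero_right]
  exact dist_convolution_le ((norm_nonneg _).trans (hM 0)) (unitBump n).support_normed_eq.subset
    (unitBump n).nonneg_normed (unitBump n).integral_normed hF.aestronglyMeasurable
    fun y _ => by rw [dist_zero_right]; exact hM y

theorem norm_sub_mollify_le {F : E n → G} (hF : ContDiff ℝ 1 F) {M : ℝ}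
    (hM : ∀ x, ‖fderiv ℝ F x‖ ≤ M) (x : E n) : ‖F x - mollify F x‖ ≤ M := by
  have hM0 : 0 ≤ M := (norm_nonneg _).trans (hM 0)
  rw [← dist_eq_norm, dist_comm]
  refine (unitBump n).dist_normed_convolution_le hF.continuous.aestronglyMeasurable fun y hy => ?_
  have h1 : ‖y - x‖ < 1 := by
    rw [← dist_eq_norm]
    exact hy
  rw [dist_eq_norm]
  refine (convex_univ.norm_image_sub_le_of_norm_fderiv_le
    (fun z _ => (hF.differentiable one_ne_zero) z) (fun z _ => hM z) (Set.mem_univ x)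
    (Set.mem_univ y)).trans ?_
  nlinarith

theorem norm_iteratedFDeriv_mollify_le {F : E n → G} {k : ℕ} (hF : ContDiff ℝ k F)
    (hc : HasCompactSupport F) {M : ℝ} (hM : ∀ x, ‖iteratedFDeriv ℝ k F x‖ ≤ M) (x : E n) :
    ‖iteratedFDeriv ℝ k (mollify F) x‖ ≤ M := by
  induction k generalizing G with
  | zero =>
    simp_rw [norm_iteratedFDeriv_zero] at hM ⊢
    exact norm_mollify_le hF.continuous hM x
  | succ k ih =>
    rw [← norm_iteratedFDeriv_fderiv,
      fderiv_mollify (hF.of_le (by exact_mod_cast Nat.le_add_left 1 k)) hc]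
    exact ih (hF.fderiv_right (by exact_mod_cast le_rfl)) (hc.fderiv ℝ)
      fun x => by rw [norm_iteratedFDeriv_fderiv]; exact hM x

/-- Of the $i+k$ derivatives, `k` fall on `F` and `i` on the kernel. -/
theorem norm_iteratedFDeriv_add_mollify_le {F : E n → G} {k : ℕ} (i : ℕ) (hF : ContDiff ℝ k F)
    (hc : HasCompactSupport F) {M : ℝ} (hM : ∀ x, ‖iteratedFDeriv ℝ k F x‖ ≤ M) (x : E n) :
    ‖iteratedFDeriv ℝ (i + k) (mollify F) x‖ ≤
      (∫ t, ‖iteratedFDeriv ℝ i ((unitBump n).normed volume) t‖) * M := by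
  induction k generalizing G with
  | zero =>
    simp_rw [norm_iteratedFDeriv_zero] at hM
    refine (norm_iteratedFDeriv_convolution_le hF.continuous hM i (unitBump n).contDiff_normed
      (unitBump n).hasCompactSupport_normed _ x).trans ?_
    have hM0 : 0 ≤ M := (norm_nonneg _).trans (hM 0)
    gcongr
    refine mul_le_of_le_one_left (integral_nonneg fun _ => norm_nonneg _) ?_
    exact ContinuousLinearMap.opNorm_lsmul_le
  | succ k ih =>
    rw [← add_assoc, ← norm_iteratedFDeriv_fderiv,
      fderiv_mollify (hF.of_le (by exact_mod_cast Nat.le_add_left 1 k)) hc]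
    exact ih (hF.fderiv_right (by exact_mod_cast le_rfl)) (hc.fderiv ℝ)
      fun x => by rw [norm_iteratedFDeriv_fderiv]; exact hM x

/-- By the mean value inequality on the unit ball, the error is controlled by one further
derivative; mollification commutes with differentiation, which reduces every order to order zero. -/
theorem norm_iteratedFDeriv_mollifyError_le_of_succ {F : E n → G} {k : ℕ}
    (hF : ContDiff ℝ (k + 1 : ℕ) F) (hc : HasCompactSupport F) {M : ℝ}
    (hM : ∀ x, ‖iteratedFDeriv ℝ (k + 1) F x‖ ≤ M) (x : E n) :
    ‖iteratedFDeriv ℝ k (mollifyError F) x‖ ≤ M := by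
  induction k generalizing G with
  | zero =>
    simp_rw [← norm_iteratedFDeriv_fderiv, norm_iteratedFDeriv_zero] at hM
    rw [norm_iteratedFDeriv_zero]
    exact norm_sub_mollify_le (by exact_mod_cast hF) hM x
  | succ k ih =>
    have h1 : ContDiff ℝ 1 F := hF.of_le (by exact_mod_cast Nat.le_add_left 1 (k + 1))
    have h2 : fderiv ℝ (mollifyError F) = mollifyError (fderiv ℝ F) := by
      ext1 z
      rw [mollifyError, fderiv_sub ((h1.differentiable one_ne_zero) z)
        (((contDiff_mollify h1.continuous 1).differentiable (by simp)) z), fderiv_mollify h1 hc]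
      rfl
    rw [← norm_iteratedFDeriv_fderiv, h2]
    exact ih (hF.fderiv_right (by exact_mod_cast le_rfl)) (hc.fderiv ℝ)
      fun x => by rw [norm_iteratedFDeriv_fderiv]; exact hM x

theorem norm_iteratedFDeriv_mollifyError_le {F : E n → G} {k : ℕ} (hF : ContDiff ℝ k F)
    (hc : HasCompactSupport F) {M : ℝ} (hM : ∀ x, ‖iteratedFDeriv ℝ k F x‖ ≤ M) (x : E n) :
    ‖iteratedFDeriv ℝ k (mollifyError F) x‖ ≤ 2 * M := by
  rw [mollifyError, iteratedFDeriv_sub_apply hF.contDiffAt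
    (contDiff_mollify hF.continuous k).contDiffAt]
  have := norm_iteratedFDeriv_mollify_le hF hc hM x
  linarith [norm_sub_le (iteratedFDeriv ℝ k F x) (iteratedFDeriv ℝ k (mollify F) x), hM x]

theorem norm_iteratedFDeriv_iterate_mollifyError_le_of_add {F : E n → G} {K : ℕ}
    (hF : ContDiff ℝ K F) (hc : HasCompactSupport F) {M : ℝ}
    (hM : ∀ x, ‖iteratedFDeriv ℝ K F x‖ ≤ M) (c k : ℕ) (hk : k + c = K) (x : E n) :
    ‖iteratedFDeriv ℝ k (mollifyError^[c] F) x‖ ≤ M := by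
  induction c generalizing k x with
  | zero =>
    subst hk
    exact hM x
  | succ c ih =>
    rw [Function.iterate_succ_apply']
    refine norm_iteratedFDeriv_mollifyError_le_of_succ ?_
      (hasCompactSupport_iterate_mollifyError hc c) (fun x => ih (k + 1) (by omega) x) x
    exact (contDiff_iterate_mollifyError hF c).of_le (by exact_mod_cast (by omega : k + 1 ≤ K))

theorem norm_iteratedFDeriv_iterate_mollifyError_le {F : E n → G} {k : ℕ} (hF : ContDiff ℝ k F)
    (hc : HasCompactSupport F) {M : ℝ} (hM : ∀ x, ‖iteratedFDeriv ℝ k F x‖ ≤ M) (c : ℕ) (x : E n) :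
    ‖iteratedFDeriv ℝ k (mollifyError^[c] F) x‖ ≤ 2 ^ c * M := by
  induction c generalizing x with
  | zero => simpa using hM x
  | succ c ih =>
    rw [Function.iterate_succ_apply', pow_succ', mul_assoc]
    exact norm_iteratedFDeriv_mollifyError_le (contDiff_iterate_mollifyError hF c)
      (hasCompactSupport_iterate_mollifyError hc c) ih x

/-- The `K`-fold mollification error and its first `K` derivatives are controlled by the
derivative of order `K`. -/
theorem norm_iteratedFDeriv_iterate_mollifyError_le_of_le {F : E n → G} {K : ℕ}
    (hF : ContDiff ℝ K F) (hc : HasCompactSupport F) {M : ℝ}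
    (hM : ∀ x, ‖iteratedFDeriv ℝ K F x‖ ≤ M) {k : ℕ} (hk : k ≤ K) (x : E n) :
    ‖iteratedFDeriv ℝ k (mollifyError^[K] F) x‖ ≤ 2 ^ K * M := by
  have hM0 : 0 ≤ M := (norm_nonneg _).trans (hM 0)
  -- The inner $K-k$ errors raise the order from `k` to `K`; each of the other `k` costs only a
  -- factor $2$.
  have h1 : mollifyError^[K] F = mollifyError^[k] (mollifyError^[K - k] F) := by
    rw [← Function.iterate_add_apply, Nat.add_sub_cancel' hk]
  rw [h1]
  refine (norm_iteratedFDeriv_iterate_mollifyError_le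
    ((contDiff_iterate_mollifyError hF _).of_le (by exact_mod_cast hk))
    (hasCompactSupport_iterate_mollifyError hc _)
    (norm_iteratedFDeriv_iterate_mollifyError_le_of_add hF hc hM (K - k) k (by omega)) k x).trans ?_
  gcongr
  norm_num

/-- The smooth part `F - (1 - mollify)^c F` of `F`: the derivatives of order at least `K` are
controlled by the derivative of order `K` of `F`. -/
theorem exists_norm_iteratedFDeriv_sub_iterate_mollifyError_le (n K N c : ℕ) :
    ∃ C, 0 ≤ C ∧ ∀ {F : E n → G} {M : ℝ}, ContDiff ℝ K F → HasCompactSupport F →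
      (∀ x, ‖iteratedFDeriv ℝ K F x‖ ≤ M) → ContDiff ℝ N (F - mollifyError^[c] F) ∧
        ∀ k, K ≤ k → k ≤ N → ∀ x, ‖iteratedFDeriv ℝ k (F - mollifyError^[c] F) x‖ ≤ C * M := by
  induction c with
  | zero =>
    refine ⟨0, le_rfl, fun {F M} _ _ _ => ?_⟩
    simp only [Function.iterate_zero, id, sub_self]
    exact ⟨contDiff_zero_fun, fun k _ _ x => by simp⟩
  | succ c ih =>
    obtain ⟨C, hC, ih⟩ := ih
    set I : ℕ → ℝ := fun i => ∫ t, ‖iteratedFDeriv ℝ i ((unitBump n).normed volume) t‖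
    have hI (i) : 0 ≤ I i := integral_nonneg fun _ => norm_nonneg _
    refine ⟨C + (∑ i ∈ Finset.range (N + 1), I i) * 2 ^ c,
      add_nonneg hC (mul_nonneg (Finset.sum_nonneg fun i _ => hI i) (by positivity)),
      fun {F M} hF hc hM => ?_⟩
    have hM0 : 0 ≤ M := (norm_nonneg _).trans (hM 0)
    obtain ⟨h1, h2⟩ := ih hF hc hM
    have hcd := contDiff_iterate_mollifyError hF c
    -- With `P` for mollification, $1-(1-P)^{c+1}=\bigl(1-(1-P)^c\bigr)+P(1-P)^c$; the added term is
    -- a mollification, hence smooth.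
    have h3 : F - mollifyError^[c + 1] F =
        (F - mollifyError^[c] F) + mollify (mollifyError^[c] F) := by
      rw [Function.iterate_succ_apply', mollifyError]
      abel
    have h4 := contDiff_mollify hcd.continuous N
    rw [h3]
    refine ⟨h1.add h4, fun k hKk hkN x => ?_⟩
    have hkN' : (k : WithTop ℕ∞) ≤ N := by exact_mod_cast hkN
    rw [iteratedFDeriv_add_apply (h1.of_le hkN').contDiffAt (h4.of_le hkN').contDiffAt, add_mul]
    refine (norm_add_le _ _).trans (add_le_add (h2 k hKk hkN x) ?_)
    have h5 := norm_iteratedFDeriv_add_mollify_le (k - K) hcd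
      (hasCompactSupport_iterate_mollifyError hc c)
      (norm_iteratedFDeriv_iterate_mollifyError_le hF hc hM c) x
    rw [Nat.sub_add_cancel hKk] at h5
    refine h5.trans ?_
    rw [mul_assoc]
    gcongr
    exact Finset.single_le_sum (f := I) (fun i _ => hI i) (Finset.mem_range.2 (by omega))

end Mollification

/-! ### A smooth partition of unity by integer translates -/

section PartitionOfUnity

/-- A smooth function supported in `[-1, 1]` whose integer translates sum to `1`. -/
noncomputable def tent (t : ℝ) : ℝ := Real.smoothTransition (t + 1) - Real.smoothTransition t

theorem contDiff_tent (K : ℕ) : ContDiff ℝ K tent :=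
  (Real.smoothTransition.contDiff (n := K).comp (contDiff_id.add contDiff_const)).sub
    (Real.smoothTransition.contDiff (n := K))

theorem abs_lt_one_of_tent_ne_zero {t : ℝ} (h : tent t ≠ 0) : |t| < 1 := by
  rw [abs_lt]
  constructor
  · by_contra! h'
    refine h ?_
    rw [tent, Real.smoothTransition.zero_of_nonpos (by linarith),
      Real.smoothTransition.zero_of_nonpos (by linarith), sub_zero]
  · by_contra! h'
    refine h ?_
    rw [tent, Real.smoothTransition.one_of_one_le (by linarith),
      Real.smoothTransition.one_of_one_le (by linarith), sub_self]

/-- Only $w=\lfloor t\rfloor$ and $w=\lfloor t\rfloor+1$ contribute, and their differences of smooth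
steps telescope to $1-0$. -/
theorem sum_tent_sub (t : ℝ) : ∑ w ∈ Finset.Icc ⌈t - 1⌉ ⌊t + 1⌋, tent (t - w) = 1 := by
  have h1 := Int.floor_le t
  have h2 := Int.lt_floor_add_one t
  have hne : ⌊t⌋ ≠ ⌊t⌋ + 1 := by omega
  rw [← Finset.sum_subset (s₁ := {⌊t⌋, ⌊t⌋ + 1}), Finset.sum_pair hne]
  · simp only [tent]
    push_cast
    rw [Real.smoothTransition.one_of_one_le (by linarith),
      Real.smoothTransition.zero_of_nonpos (x := t - (⌊t⌋ + 1)) (by linarith),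
      show t - (⌊t⌋ + 1 : ℝ) + 1 = t - ⌊t⌋ by ring]
    ring
  · intro w hw
    rw [Finset.mem_insert, Finset.mem_singleton] at hw
    rw [Finset.mem_Icc, Int.ceil_le, Int.le_floor]
    rcases hw with rfl | rfl
    · constructor <;> linarith
    · push_cast
      constructor <;> linarith
  · intro w _ hw
    by_contra h
    have h3 := abs_lt.1 (abs_lt_one_of_tent_ne_zero h)
    refine hw ?_
    rw [Finset.mem_insert, Finset.mem_singleton]
    have h4 : ⌊t⌋ < w + 1 := by
      have : (⌊t⌋ : ℝ) < w + 1 := by linarith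
      exact_mod_cast this
    have h5 : w < ⌊t⌋ + 2 := by
      have : (w : ℝ) < ⌊t⌋ + 2 := by linarith
      exact_mod_cast this
    omega

theorem exists_partition (n K : ℕ) : ∃ (θ : E n → ℂ) (A : ℝ), 0 < A ∧ HasDerivBounds K θ A 1 ∧
    (∀ x, θ x ≠ 0 → ∀ i, |x i| ≤ 1) ∧
    ∀ x : E n, ∑ w ∈ intPoints (fun i => x i) 1, θ (x - WithLp.toLp 2 fun i => (w i : ℝ)) = 1 := by
  set θ : E n → ℂ := fun x => ((∏ i, tent (x i) : ℝ) : ℂ)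
  have hprod : ContDiff ℝ K fun x : E n => ∏ i, tent (x i) :=
    contDiff_prod fun i _ => (contDiff_tent K).comp (EuclideanSpace.proj (𝕜 := ℝ) i).contDiff
  have hθ : ContDiff ℝ K θ := Complex.ofRealCLM.contDiff.comp hprod
  have hsupp (x : E n) (hx : θ x ≠ 0) (i : Fin n) : |x i| ≤ 1 := by
    refine (abs_lt_one_of_tent_ne_zero fun h => hx ?_).le
    have h0 : ∏ i, tent (x i) = 0 := Finset.prod_eq_zero (Finset.mem_univ i) h
    simp only [θ, h0, Complex.ofReal_zero]
  have hc : HasCompactSupport θ := by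
    refine HasCompactSupport.intro (isCompact_cube 1 0 (0 : Fin n → ℤ)) fun x hx => ?_
    by_contra h
    refine hx fun i => ?_
    simpa using hsupp x h i
  obtain ⟨A, hA, hb⟩ := exists_hasDerivBounds K hθ hc
  refine ⟨θ, A, hA, hb, hsupp, fun x => ?_⟩
  have h1 : ∏ i, ∑ w ∈ Finset.Icc ⌈x i - 1⌉ ⌊x i + 1⌋, tent (x i - w) = 1 :=
    Finset.prod_eq_one fun i _ => sum_tent_sub (x i)
  rw [Finset.prod_univ_sum] at h1
  simp only [θ, PiLp.sub_apply]
  rw [← Complex.ofReal_sum, intPoints, h1, Complex.ofReal_one]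

end PartitionOfUnity

/-! ### Smoothing an atom at finer and finer scales -/

section SmoothDecomposition

variable {n K N : ℕ} {d : ℝ}

/-- Smoothing of an atom at the levels `j + l`, `l ≥ 0`. -/
theorem exists_smoothing (n K N : ℕ) (d : ℝ) : ∃ C : ℝ, 0 < C ∧ ∀ (j : ℕ) (m : Fin n → ℤ)
    (a : E n → ℂ), IsSmoothAtom K d j m a → ∃ G : ℕ → E n → ℂ,
      (∀ l, ContDiff ℝ N (G l)) ∧
      (∀ l, HasDerivBounds K (fun x => a x - G l x) (C / (2 ^ l) ^ K) (2 ^ (j + l))) ∧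
      (∀ l k, K ≤ k → k ≤ N → ∀ x,
        ‖iteratedFDeriv ℝ k (G l) x‖ ≤ C / (2 ^ l) ^ K * (2 ^ (j + l)) ^ k) ∧
      ∀ l x, G l x ≠ 0 → ∀ i, |(2 : ℝ) ^ j * x i - m i| ≤ d + K := by
  obtain ⟨C, hC, hT⟩ := exists_norm_iteratedFDeriv_sub_iterate_mollifyError_le (G := ℂ) n K N K
  refine ⟨(n + 1) ^ K * (C + 2 ^ K), by positivity, fun j m a ha => ?_⟩
  -- The dilation makes level $j+l$ the unit scale of the mollifier; the derivative of order `K`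
  -- then has size $2^{-lK}$, the source of all the decay.
  set u : ℕ → E n → ℂ := fun l x => a (((2 : ℝ) ^ (j + l))⁻¹ • x)
  have hua (l : ℕ) (x : E n) : u l ((2 : ℝ) ^ (j + l) • x) = a x := by
    simp only [u]
    rw [smul_smul, inv_mul_cancel₀ (by positivity), one_smul]
  have hub (l : ℕ) : HasDerivBounds K (u l) ((n + 1) ^ K) (2 ^ l)⁻¹ := by
    have h1 := ha.hasDerivBounds.comp_smul (c := ((2 : ℝ) ^ (j + l))⁻¹) (by positivity)
    have h2 : ((2 : ℝ) ^ (j + l))⁻¹ * 2 ^ j = (2 ^ l)⁻¹ := by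
      rw [pow_add]
      field_simp
    rwa [h2] at h1
  have hac : HasCompactSupport a :=
    (isCompact_cube d j m).of_isClosed_subset (isClosed_tsupport a) ha.2.1
  have huc (l : ℕ) : HasCompactSupport (u l) := hac.comp_smul (by positivity)
  set M : ℕ → ℝ := fun l => (n + 1) ^ K * ((2 ^ l)⁻¹) ^ K
  have hM (l : ℕ) (x) : ‖iteratedFDeriv ℝ K (u l) x‖ ≤ M l := (hub l).2 K le_rfl x
  set R : ℕ → E n → ℂ := fun l => mollifyError^[K] (u l)
  have hR (l : ℕ) : HasDerivBounds K (R l) (2 ^ K * M l) 1 :=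
    ⟨contDiff_iterate_mollifyError (hub l).1 K, fun k hk x => by
      rw [one_pow, mul_one]
      exact norm_iteratedFDeriv_iterate_mollifyError_le_of_le (hub l).1 (huc l) (hM l) hk x⟩
  set S : ℕ → E n → ℂ := fun l => u l - R l
  have hS (l : ℕ) := hT (hub l).1 (huc l) (hM l)
  have hle1 (l : ℕ) : 2 ^ K * M l ≤ (n + 1) ^ K * (C + 2 ^ K) / (2 ^ l) ^ K := by
    simp only [M]
    rw [inv_pow, le_div_iff₀ (by positivity)]
    field_simp
    linarith
  have hle2 (l : ℕ) : C * M l ≤ (n + 1) ^ K * (C + 2 ^ K) / (2 ^ l) ^ K := by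
    simp only [M]
    rw [inv_pow, le_div_iff₀ (by positivity)]
    have : (0 : ℝ) < 2 ^ K := by positivity
    field_simp
    linarith
  refine ⟨fun l x => S l ((2 : ℝ) ^ (j + l) • x), fun l => (hS l).1.comp (contDiff_const_smul _),
    fun l => ?_, fun l k hKk hkN x => ?_, fun l x hx i => ?_⟩
  · have h1 : (fun x => a x - S l ((2 : ℝ) ^ (j + l) • x)) =
        fun x => R l ((2 : ℝ) ^ (j + l) • x) := by
      ext x
      simp only [S, Pi.sub_apply, hua]
      ring
    rw [h1]
    have h2 := (hR l).comp_smul (c := (2 : ℝ) ^ (j + l)) (by positivity)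
    rw [mul_one] at h2
    exact h2.mono (by positivity) (by positivity) (hle1 l) le_rfl
  · rw [iteratedFDeriv_comp_const_smul _ ((hS l).1.of_le (by exact_mod_cast hkN)), norm_smul,
      norm_pow, Real.norm_of_nonneg (by positivity), mul_comm]
    gcongr
    exact ((hS l).2 k hKk hkN _).trans (hle2 l)
  · have hsu (z : E n) (hz : u l z ≠ 0) (i : Fin n) :
        |z i - (WithLp.toLp 2 fun i => (2 : ℝ) ^ l * m i : E n) i| ≤ 2 ^ l * d := by
      have h1 := mem_intPoints.1 (ha.mem_intPoints hz) i
      have h3 : z i - (2 : ℝ) ^ l * m i = 2 ^ l * ((2 : ℝ) ^ j * (((2 : ℝ) ^ (j + l))⁻¹ • z) i -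
          m i) := by
        rw [PiLp.smul_apply, smul_eq_mul, pow_add]
        field_simp
      change |z i - (2 : ℝ) ^ l * m i| ≤ _
      rw [h3, abs_mul, abs_of_pos (by positivity)]
      gcongr
    have hx' : |((2 : ℝ) ^ (j + l) • x) i - (WithLp.toLp 2 fun i => (2 : ℝ) ^ l * m i : E n) i| ≤
        2 ^ l * d + K := by
      by_cases h0 : u l ((2 : ℝ) ^ (j + l) • x) = 0
      · refine iterate_mollifyError_support hsu K _ (fun h1 => hx ?_) i
        simp only [S, R, Pi.sub_apply, h0, h1, sub_zero]
      · exact (hsu _ h0 i).trans (by linarith [(K.cast_nonneg : (0 : ℝ) ≤ K)])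
    have h2 : ((2 : ℝ) ^ (j + l) • x) i - (WithLp.toLp 2 fun i => (2 : ℝ) ^ l * m i : E n) i =
        2 ^ l * (2 ^ j * x i - m i) := by
      simp only [PiLp.smul_apply, smul_eq_mul, pow_add]
      ring
    rw [h2, abs_mul, abs_of_pos (by positivity)] at hx'
    -- The `K` unit-scale mollifications enlarge the support by `K` after dilation, hence by at most
    -- `K` in units of $2^{-j}$.
    have h3 : (2 : ℝ) ^ l * d + K ≤ 2 ^ l * (d + K) := by
      have : (1 : ℝ) ≤ 2 ^ l := one_le_pow₀ one_le_two
      nlinarith [(K.cast_nonneg : (0 : ℝ) ≤ K)]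
    exact le_of_mul_le_mul_left (hx'.trans h3) (by positivity)

/-- An atom is a telescoping sum of smoother functions at the levels `j + l`, `l ≥ 0`. -/
theorem exists_telescoping (n K N : ℕ) (d : ℝ) : ∃ C : ℝ, 0 < C ∧ ∀ (j : ℕ) (m : Fin n → ℤ)
    (a : E n → ℂ), IsSmoothAtom K d j m a → ∃ g : ℕ → E n → ℂ,
      (∀ l, HasDerivBounds N (g l) (C / (2 ^ l) ^ K) (2 ^ (j + l))) ∧
      (∀ L x, ‖a x - ∑ l ∈ Finset.range (L + 1), g l x‖ ≤ C / (2 ^ L) ^ K) ∧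
      ∀ l x, g l x ≠ 0 → ∀ i, |(2 : ℝ) ^ j * x i - m i| ≤ d + K := by
  obtain ⟨C, hC, h⟩ := exists_smoothing n K N d
  refine ⟨C * (1 + 2 ^ K) + (n + 1) ^ K, by positivity, fun j m a ha => ?_⟩
  obtain ⟨G, hGc, hG1, hG2, hGs⟩ := h j m a ha
  set C' : ℝ := C * (1 + 2 ^ K) + (n + 1) ^ K
  have hCC' : C ≤ C' := by
    have h1 : (0 : ℝ) ≤ C * 2 ^ K := by positivity
    have h2 : (0 : ℝ) ≤ (n + 1) ^ K := by positivity
    simp only [C']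
    linarith
  -- Below order `K` only the errors $a-G_l$ are known to be small, so there $G_{l+1}-G_l$ is
  -- written as a difference of errors; from order `K` on, both terms are bounded separately.
  set g : ℕ → E n → ℂ := fun l => Nat.casesOn l (G 0) fun l x => G (l + 1) x - G l x
  have hsum (L : ℕ) (x : E n) : ∑ l ∈ Finset.range (L + 1), g l x = G L x := by
    rw [Finset.sum_range_succ']
    change ∑ l ∈ Finset.range L, (G (l + 1) x - G l x) + G 0 x = G L x
    rw [Finset.sum_range_sub fun l => G l x]
    ring
  refine ⟨g, fun l => ?_, fun L x => ?_, fun l x hx i => ?_⟩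
  · cases l with
    | zero =>
      refine ⟨hGc 0, fun k hk x => ?_⟩
      change ‖iteratedFDeriv ℝ k (G 0) x‖ ≤ _
      rcases le_total K k with hKk | hkK
      · refine (hG2 0 k hKk hk x).trans ?_
        gcongr
      · have h1 := ha.hasDerivBounds.sub (hG1 0)
        simp only [sub_sub_cancel] at h1
        refine (h1.2 k hkK x).trans ?_
        simp only [pow_zero, one_pow, div_one, add_zero]
        gcongr
        simp only [C']
        have : (0 : ℝ) ≤ C * 2 ^ K := by positivity
        linarith
    | succ l =>
      refine ⟨(hGc _).sub (hGc l), fun k hk x => ?_⟩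
      change ‖iteratedFDeriv ℝ k (fun x => G (l + 1) x - G l x) x‖ ≤ _
      have hpow : C / (2 ^ (l + 1)) ^ K * (2 ^ (j + (l + 1))) ^ k +
          C / (2 ^ l) ^ K * (2 ^ (j + l)) ^ k ≤
          C' / (2 ^ (l + 1)) ^ K * (2 ^ (j + (l + 1))) ^ k := by
        have h1 : (2 ^ (j + l) : ℝ) ^ k ≤ (2 ^ (j + (l + 1))) ^ k := by
          gcongr <;> norm_num
        have h2 : C / ((2 : ℝ) ^ l) ^ K = C * 2 ^ K / (2 ^ (l + 1)) ^ K := by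
          rw [pow_succ, mul_pow]
          field_simp
        calc _ ≤ C / (2 ^ (l + 1)) ^ K * (2 ^ (j + (l + 1))) ^ k +
              C * 2 ^ K / (2 ^ (l + 1)) ^ K * (2 ^ (j + (l + 1))) ^ k := by
              rw [h2]
              gcongr
          _ = C * (1 + 2 ^ K) / (2 ^ (l + 1)) ^ K * (2 ^ (j + (l + 1))) ^ k := by ring
          _ ≤ _ := by
              gcongr
              simp only [C']
              have : (0 : ℝ) ≤ (n + 1) ^ K := by positivity
              linarith
      refine le_trans ?_ hpow
      rcases le_total K k with hKk | hkK
      · have hk' : (k : WithTop ℕ∞) ≤ N := by exact_mod_cast hk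
        have := iteratedFDeriv_sub_apply (𝕜 := ℝ) (x := x) ((hGc (l + 1)).of_le hk').contDiffAt
          ((hGc l).of_le hk').contDiffAt
        change ‖iteratedFDeriv ℝ k (G (l + 1) - G l) x‖ ≤ _
        rw [this]
        exact (norm_sub_le _ _).trans
          (add_le_add (hG2 (l + 1) k hKk hk x) (hG2 l k hKk hk x))
      · have hk' : (k : WithTop ℕ∞) ≤ K := by exact_mod_cast hkK
        have h1 : (fun x => G (l + 1) x - G l x) =
            (fun x => a x - G l x) - fun x => a x - G (l + 1) x := by
          ext x
          rw [Pi.sub_apply]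
          ring
        rw [h1, iteratedFDeriv_sub_apply ((hG1 l).1.of_le hk').contDiffAt
          ((hG1 (l + 1)).1.of_le hk').contDiffAt]
        exact (norm_sub_le _ _).trans ((add_le_add ((hG1 l).2 k hkK x)
          ((hG1 (l + 1)).2 k hkK x)).trans_eq (add_comm _ _))
  · rw [hsum]
    exact ((hG1 L).norm_le x).trans (by gcongr)
  · cases l with
    | zero => exact hGs 0 x hx i
    | succ l =>
      change G (l + 1) x - G l x ≠ 0 at hx
      by_cases h0 : G l x = 0
      · exact hGs (l + 1) x (fun h1 => hx (by rw [h0, h1, sub_zero])) i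
      · exact hGs l x h0 i

end SmoothDecomposition

/-! ### Decomposing a smooth atom into smoother ones -/

section SmoothAtomDecomposition

variable {n : ℕ} {p : ℝ≥0∞}

theorem cardBound_mul_two_pow_le {D : ℝ} (hD : 0 ≤ D) (l : ℕ) :
    cardBound n (2 ^ l * D) ≤ cardBound n D * 2 ^ ((l : ℝ) * n) := by
  have h1 : (2 : ℝ≥0∞) ^ ((l : ℝ) * n) = ENNReal.ofReal ((2 ^ l) ^ n) := by
    rw [← pow_mul, ENNReal.ofReal_pow (by norm_num), ← Nat.cast_mul, ENNReal.rpow_natCast,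
      ENNReal.ofReal_ofNat]
  rw [h1, cardBound, cardBound, ← ENNReal.ofReal_mul (by positivity), ← mul_pow]
  gcongr
  nlinarith [(one_le_pow₀ one_le_two : (1 : ℝ) ≤ 2 ^ l)]

/-- A smooth atom with `K` derivatives decomposes into smooth atoms with any number of derivatives
and any dilation factor `d' ≥ 1`, with decay rate `K`. -/
theorem exists_decomposes_of_isSmoothAtom (n : ℕ) {K : ℕ} (hK : 0 < K) (N : ℕ) {d d' : ℝ}
    (hd : 0 ≤ d) (hd' : 1 ≤ d') (hp : 0 < p) : ∃ (A : ℝ≥0∞) (D : ℝ), A ≠ ∞ ∧ 0 ≤ D ∧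
      ∀ (j : ℕ) (m : Fin n → ℤ) (a : E n → ℂ), IsSmoothAtom K d j m a →
        AEStronglyMeasurable a volume ∧ (∀ x ∉ cube d j m, a x = 0) ∧
          Decomposes N d' K D A p j m a := by
  obtain ⟨C, hC, htel⟩ := exists_telescoping n K N d
  obtain ⟨θ, B, hB, hθ, hθs, hθsum⟩ := exists_partition n N
  -- The smoothed atom reaches out to $d+K$, and the partition functions add at most $1$.
  set D : ℝ := d + K + 1
  have hD : 0 ≤ D := by positivity
  set S : ℝ := 2 ^ N * B * C
  have hS : 0 < S := by positivity
  refine ⟨ENNReal.ofReal S * cardBound n D ^ (1 / p.toReal), D,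
    ENNReal.mul_ne_top ENNReal.ofReal_ne_top
      (ENNReal.rpow_ne_top_of_nonneg (by positivity) cardBound_ne_top), hD, fun j m a ha => ?_⟩
  refine ⟨ha.continuous.aestronglyMeasurable, fun x hx => ha.eq_zero hx, ?_⟩
  obtain ⟨g, hg, hga, hgs⟩ := htel j m a ha
  set y : (Fin n → ℤ) → E n := fun w => WithLp.toLp 2 fun i => (w i : ℝ)
  set θ' : ℕ → (Fin n → ℤ) → E n → ℂ := fun l w x => θ ((2 : ℝ) ^ (j + l) • x - y w)
  have hθ' (l w) : HasDerivBounds N (θ' l w) B (2 ^ (j + l)) := by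
    simpa using (hθ.comp_sub (y w)).comp_smul (c := (2 : ℝ) ^ (j + l)) (by positivity)
  have hθ's (l w x) (hx : θ' l w x ≠ 0) : w ∈ intPoints (fun i => (2 : ℝ) ^ (j + l) * x i) 1 :=
    mem_intPoints.2 fun i => hθs _ hx i
  set near : ℕ → (Fin n → ℤ) → Prop := fun l w => ∀ i, |(w i : ℝ) / 2 ^ l - m i| ≤ D
  have hnear (l w x) (hx : θ' l w x ≠ 0) (hx' : g l x ≠ 0) : near l w := fun i => by
    have h1 := mem_intPoints.1 (hθ's l w x hx) i
    have h2 := hgs l x hx' i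
    have h3 : (1 : ℝ) ≤ 2 ^ l := one_le_pow₀ one_le_two
    have h4 : (w i : ℝ) / 2 ^ l - 2 ^ j * x i = -((2 ^ (j + l) * x i - w i) / 2 ^ l) := by
      rw [pow_add]
      field_simp
      ring
    have h5 : |(w i : ℝ) / 2 ^ l - 2 ^ j * x i| ≤ 1 := by
      rw [h4, abs_neg, abs_div, abs_of_pos (by positivity : (0 : ℝ) < 2 ^ l),
        div_le_one (by positivity)]
      linarith
    calc |(w i : ℝ) / 2 ^ l - m i| ≤ |(w i : ℝ) / 2 ^ l - 2 ^ j * x i| + |2 ^ j * x i - m i| :=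
          abs_sub_le _ _ _
      _ ≤ D := by simp only [D]; linarith
  set A : ℕ → ℝ := fun l => 2 ^ N * B * (C / (2 ^ l) ^ K)
  have hA (l) : 0 < A l := by positivity
  have hAS (l) : A l = S / (2 ^ l) ^ K := by simp only [A, S]; ring
  classical
  have hsum (L : ℕ) (x : E n) : partialSum (fun l w => if near l w then (A l : ℂ) else 0)
      (fun l w x => (A l : ℂ)⁻¹ * (θ' l w x * g l x)) L x = ∑ l ∈ Finset.range L, g l x := by
    refine Finset.sum_congr rfl fun l _ => ?_
    have hAl : (A l : ℂ) ≠ 0 := by exact_mod_cast (hA l).ne'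
    have hterm (w) : (if near l w then (A l : ℂ) else 0) * ((A l : ℂ)⁻¹ * (θ' l w x * g l x)) =
        g l x * θ' l w x := by
      split_ifs with h
      · field_simp
      · rw [zero_mul]
        by_contra h0
        exact h (hnear l w x (right_ne_zero_of_mul (Ne.symm h0))
          (left_ne_zero_of_mul (Ne.symm h0)))
    simp_rw [hterm]
    rw [tsum_mul_left, tsum_eq_sum (s := intPoints (fun i => (2 : ℝ) ^ (j + l) * x i) 1)
      fun w hw => not_imp_comm.1 (hθ's l w x) hw]
    have := hθsum ((2 : ℝ) ^ (j + l) • x)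
    simp only [PiLp.smul_apply, smul_eq_mul] at this
    rw [this, mul_one]
  refine ⟨fun l w => if near l w then (A l : ℂ) else 0,
    fun l w x => (A l : ℂ)⁻¹ * (θ' l w x * g l x), fun l w => ?_, fun l w h => ?_, fun l => ?_, ?_⟩
  · refine ((hθ' l w).mul (hg l) (by positivity)).isSmoothAtom (hA l) fun x hx => ?_
    by_contra h0
    refine hx (mem_cube_iff.2 (mem_intPoints.2 fun i => ?_))
    -- The partition functions have half side $1$, which is why the new dilation factor must be at
    -- least $1$.
    exact (mem_intPoints.1 (hθ's l w x (left_ne_zero_of_mul h0)) i).trans hd'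
  · exact by_contra fun h' => h (if_neg h')
  -- At most a multiple of $2^{ln}$ coefficients are nonzero, each of size $S\,2^{-lK}$; the
  -- $\ell_p$ norm therefore decays like $2^{-l(K-n/p)}$.
  · refine (ellENorm_indicator_le hp (intPoints (fun i => 2 ^ l * (m i : ℝ)) (2 ^ l * D))
      (ENNReal.ofReal (A l)) _ (fun w _ => ?_) fun w hw => ?_).trans ?_
    · beta_reduce
      split_ifs
      · rw [← ofReal_norm, Complex.norm_real, Real.norm_of_nonneg (hA l).le]
      · simp
    · beta_reduce
      rw [if_neg, enorm_zero]
      refine fun h => hw (mem_intPoints.2 fun i => ?_)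
      have h2 : (2 : ℝ) ^ l * m i - w i = 2 ^ l * (m i - w i / 2 ^ l) := by field_simp
      rw [h2, abs_mul, abs_of_pos (by positivity), abs_sub_comm]
      gcongr
      exact h i
    · have h1 : ENNReal.ofReal (A l) = ENNReal.ofReal S * 2 ^ (-((l : ℝ) * K)) := by
        rw [hAS, div_eq_mul_inv, ENNReal.ofReal_mul hS.le, ENNReal.ofReal_inv_of_pos
          (by positivity), ENNReal.rpow_neg, ← pow_mul, ← Nat.cast_mul, ENNReal.rpow_natCast,
          ENNReal.ofReal_pow (by norm_num), ENNReal.ofReal_ofNat]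
      have h2 := (card_intPoints_le_cardBound (fun i => 2 ^ l * (m i : ℝ))
        (by positivity : 0 ≤ 2 ^ l * D)).trans (cardBound_mul_two_pow_le hD l)
      calc _ ≤ ENNReal.ofReal S * 2 ^ (-((l : ℝ) * K)) *
            (cardBound n D * 2 ^ ((l : ℝ) * n)) ^ (1 / p.toReal) := by
            rw [h1]
            gcongr
        _ = ENNReal.ofReal S * cardBound n D ^ (1 / p.toReal) * (2 ^ (-((l : ℝ) * K)) *
            2 ^ ((l : ℝ) * n * (1 / p.toReal))) := by
            rw [ENNReal.mul_rpow_of_nonneg _ _ (by positivity), ← ENNReal.rpow_mul]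
            ring
        _ = _ := by
            rw [← two_rpow_add]
            ring_nf
  -- The partial sum with $L+1$ terms telescopes to the `L`-th smoothing, whence the shift.
  · refine (tendsto_add_atTop_iff_nat 1).1 ?_
    have hle (L : ℕ) : eLpNorm (fun x => a x - partialSum
        (fun l w => if near l w then (A l : ℂ) else 0)
        (fun l w x => (A l : ℂ)⁻¹ * (θ' l w x * g l x)) (L + 1) x) p volume ≤
        ENNReal.ofReal (C / (2 ^ L) ^ K) *
          (volume (cube (d + K) 0 (0 : Fin n → ℤ)) ^ (1 / p.toReal) *
            2 ^ (-((j : ℝ) * (n / p.toReal)))) := by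
      rw [← mul_assoc]
      refine eLpNorm_le_of_support_subset_cube (m := m) (fun x hx => ?_) fun x => ?_
      · rw [hsum, ha.eq_zero fun hx' => hx fun i => (hx' i).trans (by gcongr; simp), zero_sub,
          neg_eq_zero]
        refine Finset.sum_eq_zero fun l _ => by_contra fun h0 => hx ?_
        exact mem_cube_iff.2 (mem_intPoints.2 (hgs l x h0))
      · rw [hsum, ← ofReal_norm]
        exact ENNReal.ofReal_le_ofReal (hga L x)
    refine tendsto_of_tendsto_of_tendsto_of_le_of_le tendsto_const_nhds ?_ (fun _ => zero_le) hle
    have h1 : Tendsto (fun L : ℕ => C / ((2 : ℝ) ^ L) ^ K) atTop (𝓝 0) := by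
      refine Tendsto.div_atTop tendsto_const_nhds ?_
      exact (tendsto_pow_atTop hK.ne').comp (tendsto_pow_atTop_atTop_of_one_lt one_lt_two)
    have h2 := (ENNReal.continuous_ofReal.tendsto 0).comp h1
    rw [ENNReal.ofReal_zero] at h2
    have h3 : volume (cube (d + K) 0 (0 : Fin n → ℤ)) ^ (1 / p.toReal) *
        2 ^ (-((j : ℝ) * (n / p.toReal))) ≠ ∞ :=
      ENNReal.mul_ne_top (ENNReal.rpow_ne_top_of_nonneg (by positivity)
        (isCompact_cube _ _ _).measure_lt_top.ne) (two_rpow_ne_top _)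
    simpa only [zero_mul, Function.comp_def] using ENNReal.Tendsto.mul_const h2 (Or.inr h3)

end SmoothAtomDecomposition

/-! ### The two conversions and the theorem -/

section Refinements

variable {n : ℕ} {p q : ℝ≥0∞} {s σ : ℝ}

/-- Smooth atoms with enough derivatives can be replaced by smooth atoms with any number of
derivatives and any dilation factor. -/
theorem refines_smooth_smooth (hp : 0 < p) (hq : 0 < q) (hs : 0 < s) {K : ℕ} (hK : 1 + ⌊s⌋₊ ≤ K)
    (N : ℕ) {d d' : ℝ} (hd : 0 ≤ d) (hd' : 1 ≤ d') :
    Refines (n := n) (IsSmoothAtom K d) (IsSmoothAtom N d') s p q := by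
  obtain ⟨A, D, hA, hD, h⟩ :=
    exists_decomposes_of_isSmoothAtom n (by omega : 0 < K) N hd hd' hp
  have hsK : s < K :=
    (Nat.lt_floor_add_one s).trans_le (by exact_mod_cast (add_comm _ _).trans_le hK)
  exact refines_of_decomposes hp hq hs hsK (zero_le_one.trans hd') hD hA h

theorem refines_nonsmooth_smooth (hp : 0 < p) (hq : 0 < q) (hs : 0 < s) (hsσ : s < σ) (K : ℕ)
    (d : ℝ) {d' : ℝ} (hd' : 0 ≤ d') :
    Refines (n := n) (IsNonsmoothAtom K d' σ p d) (IsSmoothAtom K d') s p q := by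
  obtain ⟨A, D, hA, hD, h⟩ := exists_decomposes_of_isNonsmoothAtom n K d σ hd' hp
  exact refines_of_decomposes hp hq hs hsσ hd' hD hA h

end Refinements

end AtomicBesov

theorem theorem2p3 (n : ℕ) (hn : 0 < n) (p q : ℝ≥0∞) (hp : 0 < p) (hq : 0 < q)
    (s σ d : ℝ) (hs : 0 < s) (hsσ : s < σ) (hd : 1 < d)
    (K₁ : ℕ) (hK₁ : 1 + ⌊s⌋₊ ≤ K₁) (d₁ : ℝ) (hd₁ : 1 < d₁)
    (K₂ : ℕ) (hK₂ : 1 + ⌊σ⌋₊ ≤ K₂) (d₂ : ℝ) (hd₂ : 1 < d₂) :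
    (∀ f : AtomicBesov.E n → ℂ, MemLp f p volume →
      (AtomicBesov.MemBesov K₁ d₁ s p q f ↔
        ∃ c a, AtomicBesov.IsRepr (AtomicBesov.IsNonsmoothAtom K₂ d₂ σ p d) s p q f c a)) ∧
    ∃ C : ℝ≥0, 0 < C ∧ ∀ f : AtomicBesov.E n → ℂ, MemLp f p volume →
      AtomicBesov.besovENorm K₁ d₁ s p q f ≤
          C * AtomicBesov.reprENorm (AtomicBesov.IsNonsmoothAtom K₂ d₂ σ p d) s p q f ∧
        AtomicBesov.reprENorm (AtomicBesov.IsNonsmoothAtom K₂ d₂ σ p d) s p q f ≤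
          C * AtomicBesov.besovENorm K₁ d₁ s p q f := by
  have h₁ : AtomicBesov.Refines (n := n) (AtomicBesov.IsSmoothAtom K₁ d₁)
      (AtomicBesov.IsNonsmoothAtom K₂ d₂ σ p d) s p q :=
    -- The intermediate smooth atoms have dilation factor $\min(d,d_2)\ge 1$, small enough to be
    -- $(\sigma,p)$-atoms and large enough for the partition of unity.
    (AtomicBesov.refines_smooth_smooth hp hq hs hK₁ K₂ (by linarith) (le_min hd.le hd₂.le)).trans
      (AtomicBesov.Refines.of_imp fun _ _ _ h => h.isNonsmoothAtom hp)
  have h₂ : AtomicBesov.Refines (n := n) (AtomicBesov.IsNonsmoothAtom K₂ d₂ σ p d)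
      (AtomicBesov.IsSmoothAtom K₁ d₁) s p q := by
    -- The intermediate $K_2$-atoms, chosen for $\sigma$, are smooth enough for the smaller exponent
    -- `s`, so they can be exchanged for $K_1$-atoms.
    have hK : 1 + ⌊s⌋₊ ≤ K₂ :=
      (Nat.add_le_add_left (Nat.floor_le_floor hsσ.le) 1).trans hK₂
    exact (AtomicBesov.refines_nonsmooth_smooth hp hq hs hsσ K₂ d (by linarith)).trans
      (AtomicBesov.refines_smooth_smooth hp hq hs hK K₁ (by linarith) hd₁.le)
  refine ⟨fun f hf => ⟨fun h => h₁.exists_isRepr hf h.2, fun h => ⟨hf, h₂.exists_isRepr hf h⟩⟩, ?_⟩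
  obtain ⟨C₁, hC₁, hle₁⟩ := h₁.exists_reprENorm_le
  obtain ⟨C₂, -, hle₂⟩ := h₂.exists_reprENorm_le
  refine ⟨max C₁ C₂, lt_max_of_lt_left hC₁, fun f hf => ⟨(hle₂ f hf).trans ?_,
    (hle₁ f hf).trans ?_⟩⟩
  · gcongr
    exact le_max_right _ _
  · gcongr
    exacts [le_max_left _ _, le_rfl]
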